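/- **Corollary (Minimal ticking clock).** *Setting.* All Hilbert spaces are finite-dimensional. A *ticking clock* consists of a Hilbert space $\tilde{\mathcal H}$, density matrices $\tilde\rho_t$ on $\tilde{\mathcal H}$, where $t$ ranges over a non-empty set of times, and a measurement with finitely many Kraus operators $A_k$, $\sum_k A_k^\dagger A_k=\mathbb 1$, that does not disturb the clock: $\sum_k A_k\tilde\rho_tA_k^\dagger=\tilde\rho_t$ for all $t$. A *Koashi–Imoto decomposition* of the states $\tilde\rho_t$ is a unitary identification of their joint support (the orthogonal complement of the vectors annihilated by all $\tilde\rho_t$; this is $\tilde{\mathcal H}$ itself if the states have full joint support) with a finite direct sum $\bigoplus_n\mathcal H_{C_n}\otimes\mathcal H_{F_n}$ such that * $\tilde\rho_t=\bigoplus_n p_{n|t}\,\rho_{n|t}\otimes\omega_n$ for all $t$, where $(p_{n|t})_n$ is a probability distribution for each $t$, the $\rho_{n|t}$ are density matrices on $\mathcal H_{C_n}$, and the $\omega_n$ are density matrices on $\mathcal H_{F_n}$ that do not depend on $t$; * whenever Kraus operators $(E_j)_j$, $\sum_jE_j^\dagger E_j=\mathbb 1$, of a channel on $\tilde{\mathcal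 H}$ satisfy $\sum_jE_j\tilde\rho_tE_j^\dagger=\tilde\rho_t$ for all $t$ (in particular for $E_j=A_j$), the $E_j$ map the joint support into itself and act on it as $\bigoplus_n\mathbb 1_{C_n}\otimes E_{j,n}$, with $\sum_jE_{j,n}^\dagger E_{j,n}=\mathbb 1_{F_n}$ and $\sum_jE_{j,n}\,\omega_n\,E_{j,n}^\dagger=\omega_n$ for all $n$. The associated measurement operators of the clock are the projectors $\tilde\Pi_k=\bigoplus_n\delta_{kn}\,\mathbb 1_{C_n}\otimes\mathbb 1_{F_n}$ onto the blocks (equal to $0$ on the complement of the joint support). *Statement.* The states of every ticking clock have a Koashi–Imoto decomposition. For every such decomposition, with measurement operators $\tilde\Pi_k$, the Hilbert space, states and measurement operators $$\mathcal H=\bigoplus_n\mathcal H_{C_n},\qquad \rho_t=\bigoplus_n p_{n|t}\,\rho_{n|t},\qquad \Pi_k=\bigoplus_n\delta_{kn}\,\mathbb 1_n$$ form a ticking clock $(\mathcal H,\rho_t,\Pi_k)$, the *minimal clock*. It has no display degrees of freedom left: the Kraus operators of any channel on $\mathcal H$ that preserves $\rho_t$ for all $t$ are of the form $\bigoplus_n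 b_{j,n}\mathbb 1_n$ with $b_{j,n}\in\mathbb C$. Moreover, there are completely positive trace-preserving maps $S:L(\tilde{\mathcal H})\to L(\mathcal H)$ and $R:L(\mathcal H)\to L(\tilde{\mathcal H})$ with $$S(\tilde\Pi_k\tilde\rho_t)=\Pi_k\rho_t,\qquad R(\Pi_k\rho_t)=\tilde\Pi_k\tilde\rho_t\qquad\text{for all } k \text{ and } t;$$ in particular $S(\tilde\rho_t)=\rho_t$ and $R(\rho_t)=\tilde\rho_t$ for all $t$. -/

import Mathlib

open scoped ComplexOrder Matrix Kronecker MatrixOrder Matrix.Norms.L2Operator CStarAlgebra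

namespace QuantumClock

/-- Density matrices (normalised states) on `ℂ^d`. -/
def IsDensity {d : Type*} [Fintype d] (ρ : Matrix d d ℂ) : Prop :=
  ρ.PosSemidef ∧ ρ.trace = 1

/-- `A` is a family of Kraus operators of a measurement (equivalently, of a quantum channel):
`∑ k, A k† A k = 1`. -/
def IsKraus {d κ : Type*} [Fintype d] [DecidableEq d] [Fintype κ]
    (A : κ → Matrix d d ℂ) : Prop :=
  ∑ k, (A k)ᴴ * A k = 1

/-- The channel with Kraus operators `A` leaves `ρ` undisturbed: `∑ k, A k ρ A k† = ρ`. -/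
def Preserves {d κ : Type*} [Fintype d] [Fintype κ]
    (A : κ → Matrix d d ℂ) (ρ : Matrix d d ℂ) : Prop :=
  ∑ k, A k * ρ * (A k)ᴴ = ρ

/-- A completely positive map (in Mathlib's sense) is a quantum channel when it also
preserves the trace. -/
def IsTracePreserving {d e : Type*} [Fintype d] [DecidableEq d] [Fintype e] [DecidableEq e]
    (Φ : Matrix d d ℂ →CP Matrix e e ℂ) : Prop :=
  ∀ X, (Φ X).trace = X.trace

/-- A ticking (independent) clock on the Hilbert space `ℂ^d`: a family of states `state t`
indexed by time and a measurement, given by Kraus operators, that does not disturb any of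
these states. -/
structure TickingClock (T d κ : Type*) [Fintype d] [DecidableEq d] [Fintype κ] where
  state : T → Matrix d d ℂ
  kraus : κ → Matrix d d ℂ
  state_isDensity : ∀ t, IsDensity (state t)
  kraus_isKraus : IsKraus kraus
  undisturbed : ∀ t, Preserves kraus (state t)

/-- A Koashi-Imoto decomposition of a family of states `ρ t` on `ℂ^d`.

The space `⨁ n, C_n ⊗ F_n`, with `C_n = ℂ^(c n)` (clockwork) and `F_n = ℂ^(f n)` (display), is
realised as `ℂ^(Σ n, Fin (c n) × Fin (f n))`; it is embedded in `ℂ^d` by the isometry `V`, whose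
range is the joint support of the states, i.e. the orthogonal complement of the vectors
annihilated by all of them. So `V` is unitary if the states have full joint support.
The states decompose as `ρ t = ⨁ n, p_{n|t} ρ_{n|t} ⊗ ω_n`, and every channel that preserves all of
the states acts on the support through Kraus operators `⨁ n, 1 ⊗ B_{k,n}`, where the channel on
`F_n` with Kraus operators `B_{k,n}` preserves `ω_n`. -/
structure KoashiImoto {T d : Type*} [Fintype d] [DecidableEq d] (ρ : T → Matrix d d ℂ) where
  /-- The number of values of the register index. -/
  N : ℕ
  /-- Dimensions of the clockwork spaces. -/
  c : Fin N → ℕ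
  /-- Dimensions of the display spaces. -/
  f : Fin N → ℕ
  V : Matrix d (Σ n, Fin (c n) × Fin (f n)) ℂ
  /-- The register probabilities `p_{n|t}`. -/
  p : T → Fin N → ℝ
  /-- The clockwork states `ρ_{n|t}`. -/
  clockwork : T → ∀ n, Matrix (Fin (c n)) (Fin (c n)) ℂ
  /-- The time-independent display states `ω_n`. -/
  display : ∀ n, Matrix (Fin (f n)) (Fin (f n)) ℂ
  isometry : Vᴴ * V = 1
  support : ∀ v : d → ℂ, (∀ t, ρ t *ᵥ v = 0) → Vᴴ *ᵥ v = 0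
  p_nonneg : ∀ t n, 0 ≤ p t n
  p_sum : ∀ t, ∑ n, p t n = 1
  clockwork_isDensity : ∀ t n, IsDensity (clockwork t n)
  display_isDensity : ∀ n, IsDensity (display n)
  state_eq : ∀ t, ρ t =
    V * Matrix.blockDiagonal' (fun n => (p t n : ℂ) • (clockwork t n ⊗ₖ display n)) * Vᴴ
  kraus_eq : ∀ (K : ℕ) (A : Fin K → Matrix d d ℂ), IsKraus A → (∀ t, Preserves A (ρ t)) →
    ∃ B : Fin K → ∀ n, Matrix (Fin (f n)) (Fin (f n)) ℂ,
      (∀ k, A k * V =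
        V * Matrix.blockDiagonal' (fun n => (1 : Matrix (Fin (c n)) (Fin (c n)) ℂ) ⊗ₖ B k n)) ∧
      (∀ n, IsKraus (fun k => B k n)) ∧
      ∀ n, Preserves (fun k => B k n) (display n)

/-- The register measurement on the original clock: the projector
`⨁ n, δ_{kn} 1_{C_n} ⊗ 1_{F_n}` onto the block with register index `k`. -/
noncomputable def KoashiImoto.registerProj {T d : Type*} [Fintype d] [DecidableEq d]
    {ρ : T → Matrix d d ℂ} (D : KoashiImoto ρ) (k : Fin D.N) : Matrix d d ℂ :=
  D.V * Matrix.blockDiagonal' (fun n =>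
    if n = k then (1 : Matrix (Fin (D.c n)) (Fin (D.c n)) ℂ) ⊗ₖ
      (1 : Matrix (Fin (D.f n)) (Fin (D.f n)) ℂ) else 0) * D.Vᴴ

/-- A family of states on `⨁ n, ℂ^(c n)` has no display degrees of freedom left: every channel that
preserves all of the states has Kraus operators of the form `⨁ n, b_{k,n} 1_n`. -/
def HasTrivialDisplay {T : Type*} {N : ℕ} (c : Fin N → ℕ)
    (ρ : T → Matrix (Σ n, Fin (c n)) (Σ n, Fin (c n)) ℂ) : Prop :=
  ∀ (K : ℕ) (A : Fin K → Matrix (Σ n, Fin (c n)) (Σ n, Fin (c n)) ℂ),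
    IsKraus A → (∀ t, Preserves A (ρ t)) →
    ∃ b : Fin K → Fin N → ℂ, ∀ k, A k = Matrix.blockDiagonal' (fun n =>
      b k n • (1 : Matrix (Fin (c n)) (Fin (c n)) ℂ))

end QuantumClock

/-!
# Koashi-Imoto decompositions and the minimal ticking clock

*Existence of the decomposition.* On the joint support of the states `ρ t`, some linear combination
`σ` of them is positive definite, and every channel preserving all `ρ t` preserves `σ` and maps the
support to itself (`exists_posSemidef_mem_span`, `kraus_mul_isometry`). So let `σ` be positive
definite. Let `𝓑` be the set of all Kraus operators of channels preserving all `ρ t`, together with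
their adjoints. Complete reducibility and Schur's lemma give a unitary that brings `𝓑` into the form
`⨁ n, 1 ⊗ B n` and its commutant `𝓑'` into the form `⨁ n, y n ⊗ 1`
(`IsStarFamily.exists_isotypic_decomposition`).

It remains to bring the states into the form `⨁ n, x n ⊗ ω n`. If a channel with Kraus operators
`A k` fixes `σ` and `X * σ`, then the sum of the expectations of `[A k, X]ᴴ * [A k, X]` in `σ`
telescopes to zero, so `X` commutes with all `A k` (`commute_of_fixes_mul`). Consequently every
common fixed point of the channels is of the form `X * σ` with `X` in `𝓑'`
(`exists_density_of_fixed`). This applies to `ρ t`, and to `σ * X` for `X` in `𝓑'`. The latter shows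
that conjugation by `σ` maps `𝓑'` to itself, which forces `σ = ⨁ n, g n ⊗ ω n`
(`exists_eq_blockDiagonal_kronecker`): the partial trace `g n` of a block of `σ` implements the same
automorphism as the block itself. Hence `ρ t = ⨁ n, (x n * g n) ⊗ ω n`.

*The minimal clock.* The recovery channel attaches the displays in their states `ω n`, the reduction
channel is the partial trace over them (`KoashiImoto.exists_recovery`,
`KoashiImoto.exists_reduction`). Given a channel with Kraus operators `A k` that preserves the
states of the minimal clock, the channel "reduce, apply `A`, recover" preserves the states of the
original one. So its Kraus operators, essentially `(1 ⊗ √ω |x⟩) * A k * (1 ⊗ ⟨x'|)`, are of the form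
`⨁ n, 1 ⊗ B n`, and comparing entries shows that `A k` is a scalar on every block
(`KoashiImoto.hasTrivialDisplay_minimalState`).
-/

namespace QuantumClock

/-! ### Complete reducibility and Schur's lemma -/

section Structure

universe u

variable {ι : Type*}

/-- The family `A` of matrices is irreducible: only scalars commute with all of its members. -/
def HasTrivialCommutant {m : Type*} [Fintype m] [DecidableEq m] (A : ι → Matrix m m ℂ) : Prop :=
  ∀ Y : Matrix m m ℂ, (∀ a, A a * Y = Y * A a) → ∃ c : ℂ, Y = c • 1

/-- The family `A` of matrices is closed under the adjoint, `j a` being the index of `(A a)ᴴ`. -/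
def IsStarFamily {m : Type*} (j : ι → ι) (A : ι → Matrix m m ℂ) : Prop :=
  ∀ a, A (j a) = (A a)ᴴ

theorem IsStarFamily.commute_conjTranspose {m : Type*} [Fintype m] {j : ι → ι}
    {A : ι → Matrix m m ℂ} (hA : IsStarFamily j A) {Y : Matrix m m ℂ}
    (hY : ∀ a, A a * Y = Y * A a) (a : ι) : A a * Yᴴ = Yᴴ * A a := by
  have h := congrArg Matrix.conjTranspose (hY (j a))
  rw [Matrix.conjTranspose_mul, Matrix.conjTranspose_mul, hA a,
    Matrix.conjTranspose_conjTranspose] at h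
  exact h.symm

/-- If a family closed under the adjoint commutes with some non-scalar matrix, then it commutes
with a non-scalar Hermitian one, namely its real or its imaginary part. -/
theorem IsStarFamily.exists_isHermitian {m : Type*} [Fintype m] [DecidableEq m] {j : ι → ι}
    {A : ι → Matrix m m ℂ} (hA : IsStarFamily j A) (h : ¬ HasTrivialCommutant A) :
    ∃ Y : Matrix m m ℂ, Y.IsHermitian ∧ (∀ a, A a * Y = Y * A a) ∧ ∀ c : ℂ, Y ≠ c • 1 := by
  by_contra! hcon
  refine h fun Y hY => ?_
  have hY' := hA.commute_conjTranspose hY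
  obtain ⟨c, hc⟩ := hcon (Y + Yᴴ) (by
    rw [Matrix.IsHermitian, Matrix.conjTranspose_add, Matrix.conjTranspose_conjTranspose, add_comm])
    fun a => by rw [mul_add, add_mul, hY, hY']
  obtain ⟨e, he⟩ := hcon (Complex.I • (Y - Yᴴ)) (by
    rw [Matrix.IsHermitian, Matrix.conjTranspose_smul, Matrix.conjTranspose_sub,
      Matrix.conjTranspose_conjTranspose, Complex.star_def, Complex.conj_I, neg_smul, ← smul_neg,
      neg_sub])
    fun a => by rw [mul_smul_comm, smul_mul_assoc, mul_sub, sub_mul, hY, hY']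
  refine ⟨(1 / 2 : ℂ) * (c - Complex.I * e), ?_⟩
  have h2 : Y = (1 / 2 : ℂ) • ((Y + Yᴴ) - Complex.I • (Complex.I • (Y - Yᴴ))) := by
    rw [smul_smul, Complex.I_mul_I]
    module
  rw [h2, hc, he]
  module

/-- A family closed under the adjoint that is not irreducible splits: an eigenspace of a
non-scalar Hermitian matrix in the commutant and the orthogonal complement of that eigenspace are
both non-zero and invariant. -/
theorem IsStarFamily.exists_split {m : Type u} [Fintype m] [DecidableEq m] {j : ι → ι}
    {A : ι → Matrix m m ℂ} (hA : IsStarFamily j A) [Nonempty m] (h : ¬ HasTrivialCommutant A) :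
    ∃ (q : m → Prop) (W : Matrix m {i // q i} ℂ) (W' : Matrix m {i // ¬ q i} ℂ)
      (_ : Fintype {i // q i}) (_ : Fintype {i // ¬ q i}),
      (∃ i, q i) ∧ (∃ i, ¬ q i) ∧ Wᴴ * W = 1 ∧ W'ᴴ * W' = 1 ∧ Wᴴ * W' = 0 ∧
      W * Wᴴ + W' * W'ᴴ = 1 ∧ ∀ a, Wᴴ * A a * W' = 0 ∧ W'ᴴ * A a * W = 0 := by
  classical
  obtain ⟨Y, hY, hcomm, hns⟩ := hA.exists_isHermitian h
  set U : Matrix m m ℂ := (hY.eigenvectorUnitary : Matrix m m ℂ) with hU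
  set l := hY.eigenvalues with hl
  have hUU : Uᴴ * U = 1 := Matrix.mem_unitaryGroup_iff'.1 hY.eigenvectorUnitary.2
  have hUU' : U * Uᴴ = 1 := Matrix.mem_unitaryGroup_iff.1 hY.eigenvectorUnitary.2
  have hspec : Y = U * Matrix.diagonal (fun i => (l i : ℂ)) * Uᴴ := by
    have := hY.spectral_theorem
    rw [Unitary.conjStarAlgAut_apply] at this
    exact this
  obtain ⟨i₀⟩ := ‹Nonempty m›
  -- entries of `A a` in the eigenbasis vanish between different eigenvalues
  have hent : ∀ a i k, l i ≠ l k → (Uᴴ * A a * U) i k = 0 := by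
    intro a i k hik
    have h1 : (Uᴴ * A a * U) * Matrix.diagonal (fun i => (l i : ℂ)) =
        Matrix.diagonal (fun i => (l i : ℂ)) * (Uᴴ * A a * U) := by
      have h2 := hcomm a
      rw [hspec] at h2
      have h3 := congrArg (fun M => Uᴴ * M * U) h2
      simp only [Matrix.mul_assoc, hUU, Matrix.mul_one] at h3
      simp only [← Matrix.mul_assoc, hUU, Matrix.one_mul] at h3
      simpa only [Matrix.mul_assoc] using h3
    have h2 := congrFun (congrFun h1 i) k
    rw [Matrix.mul_diagonal, Matrix.diagonal_mul] at h2
    have h3 : ((l i : ℂ) - l k) * (Uᴴ * A a * U) i k = 0 := by linear_combination -h2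
    rcases mul_eq_zero.1 h3 with h4 | h4
    · exact absurd (by exact_mod_cast sub_eq_zero.1 h4) hik
    · exact h4
  refine ⟨fun i => l i = l i₀, U.submatrix id Subtype.val, U.submatrix id Subtype.val,
    inferInstance, inferInstance, ⟨i₀, rfl⟩, ?_, ?_, ?_, ?_, ?_, fun a => ⟨?_, ?_⟩⟩
  · by_contra! hall
    refine hns (l i₀) ?_
    rw [hspec, show (fun i => (l i : ℂ)) = fun _ => (l i₀ : ℂ) from funext fun i => by rw [hall i],
      ← Matrix.smul_one_eq_diagonal, Matrix.mul_smul, Matrix.mul_one, Matrix.smul_mul, hUU']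
  · rw [Matrix.conjTranspose_submatrix, ← Matrix.submatrix_mul _ _ _ _ _ Function.bijective_id,
      hUU, Matrix.submatrix_one _ Subtype.val_injective]
  · rw [Matrix.conjTranspose_submatrix, ← Matrix.submatrix_mul _ _ _ _ _ Function.bijective_id,
      hUU, Matrix.submatrix_one _ Subtype.val_injective]
  · rw [Matrix.conjTranspose_submatrix, ← Matrix.submatrix_mul _ _ _ _ _ Function.bijective_id,
      hUU]
    ext ⟨i, hi⟩ ⟨k, hk⟩
    rw [Matrix.submatrix_apply, Matrix.one_apply_ne, Matrix.zero_apply]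
    rintro rfl
    exact hk hi
  · rw [← hUU']
    ext i k
    simp only [Matrix.add_apply, Matrix.mul_apply, Matrix.submatrix_apply,
      Matrix.conjTranspose_apply, id]
    exact Fintype.sum_subtype_add_sum_subtype (fun i => l i = l i₀) fun r => U i r * star (U k r)
  · ext ⟨i, hi⟩ ⟨k, hk⟩
    exact hent a i k fun hik => hk (hik.symm.trans hi)
  · ext ⟨i, hi⟩ ⟨k, hk⟩
    exact hent a i k fun hik => hi (hik.trans hk)

/-- Complete reducibility: the space on which a family closed under the adjoint acts is an
orthogonal sum of non-zero irreducible invariant subspaces, the ranges of the isometries `V i`. -/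
theorem IsStarFamily.exists_irreducible_decomposition (k : ℕ) :
    ∀ {m : Type u} [Fintype m] [DecidableEq m] {j : ι → ι} {A : ι → Matrix m m ℂ},
    IsStarFamily j A → Fintype.card m = k →
    ∃ (I : Type) (_ : Fintype I) (g : I → ℕ) (V : ∀ i, Matrix m (Fin (g i)) ℂ),
      (∀ i, (V i)ᴴ * V i = 1) ∧ (∀ i i', i ≠ i' → (V i)ᴴ * V i' = 0) ∧
      ∑ i, V i * (V i)ᴴ = 1 ∧ (∀ i a, A a * V i = V i * ((V i)ᴴ * A a * V i)) ∧
      ∀ i, 0 < g i ∧ HasTrivialCommutant (fun a => (V i)ᴴ * A a * V i) := by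
  induction k using Nat.strong_induction_on with
  | _ k ih =>
  intro m _ _ j A hA hk
  rcases isEmpty_or_nonempty m with hm | hm
  · exact ⟨Empty, inferInstance, Empty.elim, fun i => i.elim, fun i => i.elim, fun i => i.elim,
      Subsingleton.elim _ _, fun i => i.elim, fun i => i.elim⟩
  by_cases h : HasTrivialCommutant A
  · let e := Fintype.equivFin m
    have h1 : ((1 : Matrix m m ℂ).submatrix id e.symm)ᴴ * (1 : Matrix m m ℂ).submatrix id e.symm
        = 1 := by
      rw [Matrix.conjTranspose_submatrix, ← Matrix.submatrix_mul _ _ _ _ _ Function.bijective_id,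
        Matrix.conjTranspose_one, Matrix.one_mul, Matrix.submatrix_one _ e.symm.injective]
    have h2 : (1 : Matrix m m ℂ).submatrix id e.symm * ((1 : Matrix m m ℂ).submatrix id e.symm)ᴴ
        = 1 := by
      rw [Matrix.conjTranspose_submatrix, ← Matrix.submatrix_mul _ _ _ _ _ e.symm.bijective,
        Matrix.conjTranspose_one, Matrix.one_mul, Matrix.submatrix_id_id]
    set V := (1 : Matrix m m ℂ).submatrix id e.symm
    refine ⟨Unit, inferInstance, fun _ => Fintype.card m, fun _ => V, fun _ => h1,
      fun i i' hi => absurd (Subsingleton.elim _ _) hi, by simpa using h2, fun _ a => ?_,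
      fun _ => ⟨Fintype.card_pos, fun Y hY => ?_⟩⟩
    · rw [← Matrix.mul_assoc, ← Matrix.mul_assoc, h2, Matrix.one_mul]
    · obtain ⟨c, hc⟩ := h (V * Y * Vᴴ) fun a => by
        have := congrArg (fun M => V * M * Vᴴ) (hY a)
        simp only [Matrix.mul_assoc, h2, Matrix.mul_one] at this
        simp only [← Matrix.mul_assoc, h2, Matrix.one_mul] at this
        simpa only [Matrix.mul_assoc] using this
      refine ⟨c, ?_⟩
      have := congrArg (fun M => Vᴴ * M * V) hc
      simp only [Matrix.mul_assoc, h1, Matrix.mul_one] at this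
      simp only [← Matrix.mul_assoc, h1, Matrix.one_mul] at this
      rw [this, Matrix.mul_smul, Matrix.smul_mul, Matrix.mul_one, h1]
  · obtain ⟨q, W, W', _, _, ⟨i₁, hi₁⟩, ⟨i₂, hi₂⟩, hW, hW', hWW', hsum, hinv⟩ := hA.exists_split h
    classical
    have key : ∀ {p : Type u} [Fintype p] [DecidableEq p] (X : Matrix m p ℂ),
        IsStarFamily j (fun a => Xᴴ * A a * X) := fun X a => by
      simp only [hA a, Matrix.conjTranspose_mul, Matrix.conjTranspose_conjTranspose,
        Matrix.mul_assoc]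
    obtain ⟨I, _, g, V, h1, h2, h3, h4, h5⟩ := ih _
      (hk ▸ Fintype.card_subtype_lt (p := q) hi₂) (key W) rfl
    obtain ⟨I', _, g', V', h1', h2', h3', h4', h5'⟩ := ih _
      (hk ▸ Fintype.card_subtype_lt (p := fun i => ¬ q i) (not_not.2 hi₁)) (key W') rfl
    have hAW : ∀ a, A a * W = W * (Wᴴ * A a * W) := fun a => by
      calc A a * W = (W * Wᴴ + W' * W'ᴴ) * (A a * W) := by rw [hsum, Matrix.one_mul]
        _ = W * (Wᴴ * A a * W) + W' * (W'ᴴ * A a * W) := by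
          simp only [Matrix.add_mul, Matrix.mul_assoc]
        _ = _ := by rw [(hinv a).2, Matrix.mul_zero, add_zero]
    have hAW' : ∀ a, A a * W' = W' * (W'ᴴ * A a * W') := fun a => by
      calc A a * W' = (W * Wᴴ + W' * W'ᴴ) * (A a * W') := by rw [hsum, Matrix.one_mul]
        _ = W * (Wᴴ * A a * W') + W' * (W'ᴴ * A a * W') := by
          simp only [Matrix.add_mul, Matrix.mul_assoc]
        _ = _ := by rw [(hinv a).1, Matrix.mul_zero, zero_add]
    have hWW'' : W'ᴴ * W = 0 := by
      have := congrArg Matrix.conjTranspose hWW'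
      rwa [Matrix.conjTranspose_mul, Matrix.conjTranspose_conjTranspose,
        Matrix.conjTranspose_zero] at this
    -- products of composed isometries and compressions along them
    have hcomp : ∀ {p r : Type u} {e f : ℕ} [Fintype p] [Fintype r] (X : Matrix m p ℂ)
        (X' : Matrix m r ℂ) (Z : Matrix p (Fin e) ℂ) (Z' : Matrix r (Fin f) ℂ),
        (X * Z)ᴴ * (X' * Z') = Zᴴ * (Xᴴ * X') * Z' := by
      intros; simp only [Matrix.conjTranspose_mul, Matrix.mul_assoc]
    have hcompr : ∀ {p : Type u} {e : ℕ} [Fintype p] (X : Matrix m p ℂ) (Z : Matrix p (Fin e) ℂ)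
        (a : ι), (X * Z)ᴴ * A a * (X * Z) = Zᴴ * (Xᴴ * A a * X) * Z := by
      intros; simp only [Matrix.conjTranspose_mul, Matrix.mul_assoc]
    refine ⟨I ⊕ I', inferInstance, Sum.elim g g', fun i => match i with
      | Sum.inl i => W * V i
      | Sum.inr i => W' * V' i, ?_, ?_, ?_, ?_, ?_⟩
    · rintro (i | i)
      · change (W * V i)ᴴ * (W * V i) = 1
        rw [hcomp, hW, Matrix.mul_one, h1]
      · change (W' * V' i)ᴴ * (W' * V' i) = 1
        rw [hcomp, hW', Matrix.mul_one, h1']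
    · rintro (i | i) (i' | i') hii
      · change (W * V i)ᴴ * (W * V i') = 0
        rw [hcomp, hW, Matrix.mul_one, h2 _ _ fun h => hii (congrArg _ h)]
      · change (W * V i)ᴴ * (W' * V' i') = 0
        rw [hcomp, hWW', Matrix.mul_zero, Matrix.zero_mul]
      · change (W' * V' i)ᴴ * (W * V i') = 0
        rw [hcomp, hWW'', Matrix.mul_zero, Matrix.zero_mul]
      · change (W' * V' i)ᴴ * (W' * V' i') = 0
        rw [hcomp, hW', Matrix.mul_one, h2' _ _ fun h => hii (congrArg _ h)]
    · rw [Fintype.sum_sum_type, ← hsum]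
      congr 1
      · calc ∑ i, W * V i * (W * V i)ᴴ = W * (∑ i, V i * (V i)ᴴ) * Wᴴ := by
              simp only [Matrix.mul_sum, Matrix.sum_mul, Matrix.conjTranspose_mul, Matrix.mul_assoc]
          _ = _ := by rw [h3, Matrix.mul_one]
      · calc ∑ i, W' * V' i * (W' * V' i)ᴴ = W' * (∑ i, V' i * (V' i)ᴴ) * W'ᴴ := by
              simp only [Matrix.mul_sum, Matrix.sum_mul, Matrix.conjTranspose_mul, Matrix.mul_assoc]
          _ = _ := by rw [h3', Matrix.mul_one]
    · rintro (i | i) a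
      · change A a * (W * V i) = W * V i * ((W * V i)ᴴ * A a * (W * V i))
        rw [hcompr, ← Matrix.mul_assoc, hAW, Matrix.mul_assoc W, h4, ← Matrix.mul_assoc W]
      · change A a * (W' * V' i) = W' * V' i * ((W' * V' i)ᴴ * A a * (W' * V' i))
        rw [hcompr, ← Matrix.mul_assoc, hAW', Matrix.mul_assoc W', h4', ← Matrix.mul_assoc W']
    · rintro (i | i)
      · refine ⟨(h5 i).1, ?_⟩
        change HasTrivialCommutant fun a => (W * V i)ᴴ * A a * (W * V i)
        simpa only [hcompr] using (h5 i).2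
      · refine ⟨(h5' i).1, ?_⟩
        change HasTrivialCommutant fun a => (W' * V' i)ᴴ * A a * (W' * V' i)
        simpa only [hcompr] using (h5' i).2

/-- Schur's lemma for families closed under the adjoint: rescaling a non-zero intertwiner between
two irreducible families gives a unitary one. -/
theorem IsStarFamily.exists_unitary_intertwiner {p q : Type*} [Fintype p] [DecidableEq p]
    [Fintype q] [DecidableEq q] {j : ι → ι} {B : ι → Matrix p p ℂ} {C : ι → Matrix q q ℂ}
    (hB : IsStarFamily j B) (hC : IsStarFamily j C) (hB' : HasTrivialCommutant B)
    (hC' : HasTrivialCommutant C) {Y : Matrix p q ℂ} (hY : ∀ a, B a * Y = Y * C a) (h0 : Y ≠ 0) :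
    ∃ T : Matrix p q ℂ, Tᴴ * T = 1 ∧ T * Tᴴ = 1 ∧ ∀ a, B a * T = T * C a := by
  have hY' : ∀ a, Yᴴ * B a = C a * Yᴴ := fun a => by
    have h := congrArg Matrix.conjTranspose (hY (j a))
    simpa only [Matrix.conjTranspose_mul, hB a, hC a, Matrix.conjTranspose_conjTranspose] using h
  obtain ⟨c, hc⟩ := hC' (Yᴴ * Y) fun a => by
    rw [← Matrix.mul_assoc, ← hY', Matrix.mul_assoc, hY, Matrix.mul_assoc]
  obtain ⟨e, he⟩ := hB' (Y * Yᴴ) fun a => by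
    rw [← Matrix.mul_assoc, hY, Matrix.mul_assoc, ← hY', Matrix.mul_assoc]
  have hce : e = c := by
    have h : (e - c) • Y = 0 := by
      have := Matrix.mul_assoc Y Yᴴ Y
      rw [hc, he, Matrix.mul_smul, Matrix.smul_mul, Matrix.mul_one, Matrix.one_mul] at this
      rw [sub_smul, this, sub_self]
    exact sub_eq_zero.1 ((smul_eq_zero.1 h).resolve_right h0)
  subst hce
  have hne : e ≠ 0 := by
    rintro rfl
    rw [zero_smul] at hc
    exact h0 (Matrix.conjTranspose_mul_self_eq_zero.1 hc)
  obtain ⟨b⟩ : Nonempty q := by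
    by_contra hq
    rw [not_nonempty_iff] at hq
    exact h0 (Matrix.ext fun _ k => hq.elim k)
  have hpos : 0 ≤ e := by
    have := (Matrix.posSemidef_conjTranspose_mul_self Y).diag_nonneg (i := b)
    rwa [hc, Matrix.smul_apply, Matrix.one_apply_eq, smul_eq_mul, mul_one] at this
  obtain ⟨r, hr, rfl⟩ : ∃ r : ℝ, 0 ≤ r ∧ (r : ℂ) = e := by
    rw [Complex.nonneg_iff] at hpos
    exact ⟨e.re, hpos.1, Complex.ext rfl hpos.2⟩
  have hr0 : r ≠ 0 := by exact_mod_cast hne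
  have hs : ((((√r)⁻¹ : ℝ) : ℂ) * (((√r)⁻¹ : ℝ) : ℂ)) * (r : ℂ) = 1 := by
    rw [← Complex.ofReal_mul, ← mul_inv, Real.mul_self_sqrt hr, ← Complex.ofReal_mul,
      inv_mul_cancel₀ hr0, Complex.ofReal_one]
  refine ⟨(((√r)⁻¹ : ℝ) : ℂ) • Y, ?_, ?_, fun a => ?_⟩
  · rw [Matrix.conjTranspose_smul, Complex.star_def, Complex.conj_ofReal, Matrix.smul_mul,
      Matrix.mul_smul, hc, smul_smul, smul_smul, hs, one_smul]
  · rw [Matrix.conjTranspose_smul, Complex.star_def, Complex.conj_ofReal, Matrix.smul_mul,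
      Matrix.mul_smul, he, smul_smul, smul_smul, hs, one_smul]
  · rw [Matrix.mul_smul, Matrix.smul_mul, hY]

end Structure

/-! ### The isotypic decomposition -/

section Isotypic

variable {ι : Type*}

/-- The matrix whose columns, indexed by `(n, (i, b))`, are the columns `b` of the blocks
`Z n i`. -/
def blockColumns {m : Type*} {N : ℕ} {c f : Fin N → ℕ}
    (Z : ∀ n, Fin (c n) → Matrix m (Fin (f n)) ℂ) : Matrix m (Σ n, Fin (c n) × Fin (f n)) ℂ :=
  Matrix.of fun r x => Z x.1 x.2.1 r x.2.2

theorem blockColumns_conjTranspose_mul {m : Type*} [Fintype m] {N : ℕ} {c f : Fin N → ℕ}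
    (Z : ∀ n, Fin (c n) → Matrix m (Fin (f n)) ℂ) (X : Matrix m m ℂ)
    (x y : Σ n, Fin (c n) × Fin (f n)) :
    ((blockColumns Z)ᴴ * X * blockColumns Z) x y =
      ((Z x.1 x.2.1)ᴴ * X * Z y.1 y.2.1) x.2.2 y.2.2 := rfl

theorem blockColumns_mul_conjTranspose {m : Type*} [Fintype m] {N : ℕ} {c f : Fin N → ℕ}
    (Z : ∀ n, Fin (c n) → Matrix m (Fin (f n)) ℂ) :
    blockColumns Z * (blockColumns Z)ᴴ = ∑ x : Σ n, Fin (c n), Z x.1 x.2 * (Z x.1 x.2)ᴴ := by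
  ext r s
  simp only [Matrix.mul_apply, Matrix.sum_apply, Fintype.sum_sigma, Fintype.sum_prod_type]
  rfl

/-- Structure of a family `A` closed under the adjoint and of its commutant: up to a unitary,
`A` acts as `⨁ n, 1 ⊗ B n` and its commutant consists of matrices `⨁ n, y n ⊗ 1`. The blocks are the
isomorphism classes of irreducible subspaces, `c n` being the multiplicity and `f n` the dimension.
-/
theorem IsStarFamily.exists_isotypic_decomposition {m : Type*} [Fintype m] [DecidableEq m]
    {j : ι → ι} {A : ι → Matrix m m ℂ} (hA : IsStarFamily j A) :
    ∃ (N : ℕ) (c f : Fin N → ℕ) (U : Matrix m (Σ n, Fin (c n) × Fin (f n)) ℂ),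
      Uᴴ * U = 1 ∧ U * Uᴴ = 1 ∧ (∀ n, 0 < c n ∧ 0 < f n) ∧
      (∀ a, ∃ B : ∀ n, Matrix (Fin (f n)) (Fin (f n)) ℂ, Uᴴ * A a * U =
        Matrix.blockDiagonal' fun n => (1 : Matrix (Fin (c n)) (Fin (c n)) ℂ) ⊗ₖ B n) ∧
      ∀ X, (∀ a, A a * X = X * A a) → ∃ y : ∀ n, Matrix (Fin (c n)) (Fin (c n)) ℂ, Uᴴ * X * U =
        Matrix.blockDiagonal' fun n => y n ⊗ₖ (1 : Matrix (Fin (f n)) (Fin (f n)) ℂ) := by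
  classical
  obtain ⟨I, _, g, V, h1, h2, h3, h4, h5⟩ := hA.exists_irreducible_decomposition _ rfl
  set B : ∀ i, ι → Matrix (Fin (g i)) (Fin (g i)) ℂ := fun i a => (V i)ᴴ * A a * V i with hB
  have hBstar : ∀ i, IsStarFamily j (B i) := fun i a => by
    simp only [hB, hA a, Matrix.conjTranspose_mul, Matrix.conjTranspose_conjTranspose,
      Matrix.mul_assoc]
  -- unitary equivalence of the irreducible constituents
  let r : Setoid I :=
    { r := fun i i' => ∃ T : Matrix (Fin (g i)) (Fin (g i')) ℂ, Tᴴ * T = 1 ∧ T * Tᴴ = 1 ∧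
        ∀ a, B i a * T = T * B i' a
      iseqv := by
        refine ⟨fun i => ⟨1, by simp, by simp, fun a => by simp⟩, ?_, ?_⟩
        · rintro i i' ⟨T, hT, hT', hTB⟩
          refine ⟨Tᴴ, by simpa using hT', by simpa using hT, fun a => ?_⟩
          calc B i' a * Tᴴ = Tᴴ * (T * B i' a) * Tᴴ := by
                rw [← Matrix.mul_assoc, hT, Matrix.one_mul]
            _ = Tᴴ * B i a := by
                rw [← hTB, Matrix.mul_assoc, Matrix.mul_assoc, hT', Matrix.mul_one]
        · rintro i i' i'' ⟨T, hT, hT', hTB⟩ ⟨S, hS, hS', hSB⟩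
          refine ⟨T * S, ?_, ?_, fun a => ?_⟩
          · rw [Matrix.conjTranspose_mul, Matrix.mul_assoc, ← Matrix.mul_assoc Tᴴ, hT,
              Matrix.one_mul, hS]
          · rw [Matrix.conjTranspose_mul, Matrix.mul_assoc, ← Matrix.mul_assoc S, hS',
              Matrix.one_mul, hT']
          · rw [← Matrix.mul_assoc, hTB, Matrix.mul_assoc, hSB, Matrix.mul_assoc] }
  let e : Quotient r ≃ Fin (Fintype.card (Quotient r)) := Fintype.equivFin _
  let F : I → Fin (Fintype.card (Quotient r)) := fun i => e ⟦i⟧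
  have hF : ∀ i i', F i = F i' ↔ r i i' := fun i i' => by
    simp only [F, e.apply_eq_iff_eq, Quotient.eq]
  let rep : Fin (Fintype.card (Quotient r)) → I := fun n => (e.symm n).out
  have hrep : ∀ n, F (rep n) = n := fun n => by simp [F, rep]
  let ε : ∀ n, Fin (Fintype.card {i // F i = n}) ≃ {i // F i = n} :=
    fun n => (Fintype.equivFin _).symm
  have hT : ∀ n (k : Fin (Fintype.card {i // F i = n})), r (ε n k).1 (rep n) := fun n k =>
    (hF _ _).1 ((ε n k).2.trans (hrep n).symm)
  choose T hT1 hT2 hTB using hT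
  -- all constituents of a class are identified with its representative
  set Z : ∀ n, Fin (Fintype.card {i // F i = n}) → Matrix m (Fin (g (rep n))) ℂ :=
    fun n k => V (ε n k).1 * T n k with hZ
  have hZ1 : ∀ n k, (Z n k)ᴴ * Z n k = 1 := fun n k => by
    simp only [hZ, Matrix.conjTranspose_mul]
    rw [Matrix.mul_assoc, ← Matrix.mul_assoc (V _)ᴴ, h1, Matrix.one_mul, hT1]
  have hZ2 : ∀ n k n' k', (ε n k).1 ≠ (ε n' k').1 → (Z n k)ᴴ * Z n' k' = 0 := by
    intro n k n' k' hne
    simp only [hZ, Matrix.conjTranspose_mul]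
    rw [Matrix.mul_assoc, ← Matrix.mul_assoc (V _)ᴴ, h2 _ _ hne, Matrix.zero_mul, Matrix.mul_zero]
  have hZne : ∀ n k n' k', n ≠ n' → (Z n k)ᴴ * Z n' k' = 0 := fun n k n' k' hne =>
    hZ2 _ _ _ _ fun h => hne (by rw [← (ε n k).2, h, (ε n' k').2])
  have hZne' : ∀ n k k', k ≠ k' → (Z n k)ᴴ * Z n k' = 0 := fun n k k' hne =>
    hZ2 _ _ _ _ fun h => hne ((ε n).injective (Subtype.ext h))
  have hZA : ∀ n k a, A a * Z n k = Z n k * B (rep n) a := fun n k a => by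
    simp only [hZ]
    rw [← Matrix.mul_assoc, h4, Matrix.mul_assoc, hTB n k a, ← Matrix.mul_assoc]
  have hZA' : ∀ n k a, (Z n k)ᴴ * A a = B (rep n) a * (Z n k)ᴴ := fun n k a => by
    have := congrArg Matrix.conjTranspose (hZA n k (j a))
    simpa only [Matrix.conjTranspose_mul, hA a, hBstar _ a, Matrix.conjTranspose_conjTranspose]
      using this
  have hUU' : blockColumns Z * (blockColumns Z)ᴴ = 1 := by
    rw [blockColumns_mul_conjTranspose, ← h3]
    refine Fintype.sum_equiv ((Equiv.sigmaCongrRight ε).trans (Equiv.sigmaFiberEquiv F)) _ _ ?_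
    rintro ⟨n, k⟩
    simp only [hZ, Matrix.conjTranspose_mul]
    rw [Matrix.mul_assoc, ← Matrix.mul_assoc (T n k), hT2, Matrix.one_mul]
    rfl
  refine ⟨_, _, _, blockColumns Z, ?_, hUU', fun n => ⟨?_, (h5 _).1⟩,
    fun a => ⟨fun n => B (rep n) a, ?_⟩, fun X hX => ?_⟩
  · ext ⟨n, k, b⟩ ⟨n', k', b'⟩
    rw [← Matrix.mul_one (blockColumns Z)ᴴ, blockColumns_conjTranspose_mul, Matrix.mul_one]
    by_cases hn : n = n'
    · subst hn
      by_cases hk : k = k'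
      · subst hk
        dsimp only
        rw [hZ1]
        simp [Matrix.one_apply]
      · dsimp only
        rw [hZne' n k k' hk, Matrix.one_apply_ne, Matrix.zero_apply]
        simp [hk]
    · dsimp only
      rw [hZne n k n' k' hn, Matrix.one_apply_ne, Matrix.zero_apply]
      simp [hn]
  · exact Fintype.card_pos_iff.2 ⟨⟨rep n, hrep n⟩⟩
  · ext ⟨n, k, b⟩ ⟨n', k', b'⟩
    rw [blockColumns_conjTranspose_mul, Matrix.mul_assoc]
    dsimp only
    rw [hZA, ← Matrix.mul_assoc]
    by_cases hn : n = n'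
    · subst hn
      rw [Matrix.blockDiagonal'_apply_eq, Matrix.kroneckerMap_apply]
      by_cases hk : k = k'
      · subst hk
        rw [hZ1, Matrix.one_mul, Matrix.one_apply_eq, one_mul]
      · rw [hZne' n k k' hk, Matrix.one_apply_ne hk, Matrix.zero_mul, Matrix.zero_apply, zero_mul]
    · rw [hZne n k n' k' hn, Matrix.blockDiagonal'_apply_ne _ _ _ hn, Matrix.zero_mul,
        Matrix.zero_apply]
  · have hint : ∀ n k n' k' a, B (rep n) a * ((Z n k)ᴴ * X * Z n' k') =
        (Z n k)ᴴ * X * Z n' k' * B (rep n') a := fun n k n' k' a => by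
      calc B (rep n) a * ((Z n k)ᴴ * X * Z n' k') = (B (rep n) a * (Z n k)ᴴ) * X * Z n' k' := by
            rw [Matrix.mul_assoc (B (rep n) a), Matrix.mul_assoc (B (rep n) a)]
        _ = (Z n k)ᴴ * (A a * X) * Z n' k' := by rw [← hZA', Matrix.mul_assoc (Z n k)ᴴ]
        _ = (Z n k)ᴴ * X * (A a * Z n' k') := by
            rw [hX a, ← Matrix.mul_assoc (Z n k)ᴴ, Matrix.mul_assoc _ (A a)]
        _ = _ := by rw [hZA, ← Matrix.mul_assoc]
    have hsc : ∀ n k k', ∃ y : ℂ, (Z n k)ᴴ * X * Z n k' = y • 1 := fun n k k' =>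
      (h5 (rep n)).2 _ fun a => hint n k n k' a
    choose y hy using hsc
    refine ⟨fun n => Matrix.of (y n), ?_⟩
    ext ⟨n, k, b⟩ ⟨n', k', b'⟩
    rw [blockColumns_conjTranspose_mul]
    dsimp only
    by_cases hn : n = n'
    · subst hn
      rw [Matrix.blockDiagonal'_apply_eq, hy]
      rfl
    · rw [Matrix.blockDiagonal'_apply_ne _ _ _ hn]
      -- a non-zero block would make two different classes equivalent
      by_contra hne
      obtain ⟨S, hS⟩ := (hBstar (rep n)).exists_unitary_intertwiner (hBstar (rep n'))
        (h5 _).2 (h5 _).2 (hint n k n' k') fun h => hne (by rw [h]; rfl)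
      exact hn (by rw [← hrep n, ← hrep n']; exact (hF _ _).2 ⟨S, hS⟩)

end Isotypic

/-! ### Fixed points of channels with a faithful fixed state -/

section FixedPoints

variable {m : Type*} [Fintype m]

/-- A faithful state detects vanishing: if all `M k` have zero expectation of `(M k)ᴴ * M k` in a
positive definite `σ`, then they are zero. -/
theorem eq_zero_of_sum_trace_eq_zero {κ p : Type*} [Fintype κ] [Fintype p] {σ : Matrix m m ℂ}
    (hσ : σ.PosDef) (M : κ → Matrix p m ℂ)
    (h : ∑ k, (M k * σ * (M k)ᴴ).trace = 0) (k : κ) : M k = 0 := by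
  have hpos : ∀ k, (M k * σ * (M k)ᴴ).PosSemidef := fun k =>
    hσ.posSemidef.mul_mul_conjTranspose_same (M k)
  have htr := (Finset.sum_eq_zero_iff_of_nonneg fun k _ => (hpos k).trace_nonneg).1 h k
    (Finset.mem_univ k)
  have hz := (hpos k).trace_eq_zero_iff.1 htr
  by_contra hne
  obtain ⟨i, hi⟩ : ∃ i, M k i ≠ 0 := by
    by_contra! hall
    exact hne (funext hall)
  have hlt := hσ.dotProduct_mulVec_pos (x := star (M k i)) (by simpa using hi)
  refine hlt.ne' ?_
  have := congrFun (congrFun hz i) i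
  rw [Matrix.mul_assoc, Matrix.mul_apply] at this
  rw [star_star]
  exact this

/-- If a channel fixes a faithful state `σ` and also `σ * Xᴴ`, then its Kraus operators commute
with `X`: the sum of the expectations of `[A k, X]ᴴ * [A k, X]` in `σ` telescopes to zero. -/
theorem commute_of_fixes_mul [DecidableEq m] {κ : Type*} [Fintype κ] {σ X : Matrix m m ℂ}
    (hσ : σ.PosDef) {A : κ → Matrix m m ℂ} (hA : IsKraus A) (hAσ : Preserves A σ)
    (hX : Preserves A (σ * Xᴴ)) (k : κ) : A k * X = X * A k := by
  unfold IsKraus at hA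
  unfold Preserves at hAσ hX
  have hX' : ∑ k, A k * (X * σ) * (A k)ᴴ = X * σ := by
    have := congrArg Matrix.conjTranspose hX
    simpa only [Matrix.conjTranspose_sum, Matrix.conjTranspose_mul,
      Matrix.conjTranspose_conjTranspose, hσ.isHermitian.eq, Matrix.mul_assoc] using this
  refine sub_eq_zero.1 (eq_zero_of_sum_trace_eq_zero hσ (fun k => A k * X - X * A k) ?_ k)
  have hexp : ∀ k, ((A k * X - X * A k) * σ * (A k * X - X * A k)ᴴ).trace =
      ((A k)ᴴ * A k * (X * σ * Xᴴ)).trace - (A k * (X * σ) * (A k)ᴴ * Xᴴ).trace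
        - (X * (A k * (σ * Xᴴ) * (A k)ᴴ)).trace + (X * (A k * σ * (A k)ᴴ) * Xᴴ).trace := fun k => by
    have h1 : (A k * X - X * A k) * σ * (A k * X - X * A k)ᴴ =
        A k * (X * σ * Xᴴ * (A k)ᴴ) - A k * (X * σ) * (A k)ᴴ * Xᴴ
        - X * (A k * (σ * Xᴴ) * (A k)ᴴ) + X * (A k * σ * (A k)ᴴ) * Xᴴ := by
      simp only [Matrix.conjTranspose_sub, Matrix.conjTranspose_mul]
      noncomm_ring
    rw [h1, Matrix.trace_add, Matrix.trace_sub, Matrix.trace_sub, Matrix.trace_mul_comm (A k),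
      Matrix.mul_assoc _ (A k)ᴴ, Matrix.trace_mul_comm _ ((A k)ᴴ * A k)]
  simp only [hexp, Finset.sum_add_distrib, Finset.sum_sub_distrib, ← Matrix.trace_sum,
    ← Matrix.sum_mul, ← Matrix.mul_sum, hA, hAσ, hX, hX', Matrix.one_mul]
  simp only [Matrix.mul_assoc]
  ring

/-- If a channel fixes a faithful state, then a matrix that commutes with its Kraus operators
commutes with their adjoints as well. -/
theorem commute_conjTranspose_of_commute [DecidableEq m] {κ : Type*} [Fintype κ]
    {σ X : Matrix m m ℂ} (hσ : σ.PosDef) {A : κ → Matrix m m ℂ} (hA : IsKraus A)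
    (hAσ : Preserves A σ) (hX : ∀ k, A k * X = X * A k) (k : κ) : (A k)ᴴ * X = X * (A k)ᴴ := by
  unfold IsKraus at hA
  unfold Preserves at hAσ
  have hX' : ∀ k, (A k)ᴴ * Xᴴ = Xᴴ * (A k)ᴴ := fun k => by
    rw [← Matrix.conjTranspose_mul, ← hX, Matrix.conjTranspose_mul]
  have main : ∀ k, A k * Xᴴ - Xᴴ * A k = 0 := by
    refine eq_zero_of_sum_trace_eq_zero hσ (fun k => A k * Xᴴ - Xᴴ * A k) ?_
    have hexp : ∀ k, ((A k * Xᴴ - Xᴴ * A k) * σ * (A k * Xᴴ - Xᴴ * A k)ᴴ).trace =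
        ((A k)ᴴ * A k * (Xᴴ * σ * X)).trace - (Xᴴ * σ * ((A k)ᴴ * A k) * X).trace
          - (Xᴴ * ((A k)ᴴ * A k) * (σ * X)).trace + (Xᴴ * (A k * σ * (A k)ᴴ) * X).trace :=
      fun k => by
      have h1 : (A k * Xᴴ - Xᴴ * A k) * σ * (A k * Xᴴ - Xᴴ * A k)ᴴ =
          A k * (Xᴴ * σ * X * (A k)ᴴ) - A k * (Xᴴ * σ * ((A k)ᴴ * X))
          - (Xᴴ * A k * (σ * X)) * (A k)ᴴ + Xᴴ * (A k * σ * (A k)ᴴ) * X := by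
        simp only [Matrix.conjTranspose_sub, Matrix.conjTranspose_mul,
          Matrix.conjTranspose_conjTranspose]
        noncomm_ring
      rw [h1, Matrix.trace_add, Matrix.trace_sub, Matrix.trace_sub,
        Matrix.trace_mul_comm (A k), Matrix.mul_assoc _ (A k)ᴴ,
        Matrix.trace_mul_comm _ ((A k)ᴴ * A k), Matrix.trace_mul_comm (A k),
        Matrix.trace_mul_comm _ (A k)ᴴ]
      congr 3
      · congr 1
        rw [Matrix.mul_assoc, Matrix.mul_assoc (A k)ᴴ, ← hX, Matrix.mul_assoc (Xᴴ * σ),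
          Matrix.mul_assoc (A k)ᴴ]
      · simp only [← Matrix.mul_assoc, hX']
    simp only [hexp, Finset.sum_add_distrib, Finset.sum_sub_distrib, ← Matrix.trace_sum,
      ← Matrix.sum_mul, ← Matrix.mul_sum, hA, hAσ, Matrix.one_mul, Matrix.mul_one]
    simp only [Matrix.mul_assoc]
    ring
  have := congrArg Matrix.conjTranspose (sub_eq_zero.1 (main k))
  simpa only [Matrix.conjTranspose_mul, Matrix.conjTranspose_conjTranspose] using this.symm

/-- The Kraus operators, and their adjoints, of all channels that preserve the states `ρ t`. -/
abbrev PreservingKraus [DecidableEq m] {T : Type*} (ρ : T → Matrix m m ℂ) : Type _ :=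
  {M : Matrix m m ℂ // ∃ (K : ℕ) (A : Fin K → Matrix m m ℂ) (k : Fin K),
    IsKraus A ∧ (∀ t, Preserves A (ρ t)) ∧ (M = A k ∨ M = (A k)ᴴ)}

/-- The adjoint on `PreservingKraus ρ`. -/
def PreservingKraus.adjoint [DecidableEq m] {T : Type*} {ρ : T → Matrix m m ℂ}
    (a : PreservingKraus ρ) : PreservingKraus ρ :=
  ⟨a.1ᴴ, by
    obtain ⟨K, A, k, h1, h2, h3⟩ := a.2
    refine ⟨K, A, k, h1, h2, ?_⟩
    rcases h3 with h3 | h3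
    · exact Or.inr (by rw [h3])
    · exact Or.inl (by rw [h3, Matrix.conjTranspose_conjTranspose])⟩

theorem isStarFamily_preservingKraus [DecidableEq m] {T : Type*} (ρ : T → Matrix m m ℂ) :
    IsStarFamily PreservingKraus.adjoint (Subtype.val : PreservingKraus ρ → Matrix m m ℂ) :=
  fun _ => rfl

/-- A channel that preserves all `ρ t` preserves their linear combinations. -/
theorem preserves_of_mem_span {T κ : Type*} [Fintype κ] {ρ : T → Matrix m m ℂ}
    {A : κ → Matrix m m ℂ} (hA : ∀ t, Preserves A (ρ t)) {σ : Matrix m m ℂ}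
    (hσ : σ ∈ Submodule.span ℂ (Set.range ρ)) : Preserves A σ := by
  unfold Preserves at hA ⊢
  induction hσ using Submodule.span_induction with
  | mem x hx => obtain ⟨t, rfl⟩ := hx; exact hA t
  | zero => simp
  | add x y _ _ hx hy => simp only [Matrix.mul_add, Matrix.add_mul, Finset.sum_add_distrib, hx, hy]
  | smul c x _ hx => simp only [Matrix.mul_smul, Matrix.smul_mul, ← Finset.smul_sum, hx]

theorem mulVec_eq_zero_of_mem_span {T : Type*} {ρ : T → Matrix m m ℂ} {v : m → ℂ}
    (hv : ∀ t, ρ t *ᵥ v = 0) {σ : Matrix m m ℂ}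
    (hσ : σ ∈ Submodule.span ℂ (Set.range ρ)) : σ *ᵥ v = 0 := by
  induction hσ using Submodule.span_induction with
  | mem x hx => obtain ⟨t, rfl⟩ := hx; exact hv t
  | zero => exact Matrix.zero_mulVec v
  | add x y _ _ hx hy => rw [Matrix.add_mulVec, hx, hy, add_zero]
  | smul c x _ hx => rw [Matrix.smul_mulVec, hx, smul_zero]

/-- Radon-Nikodym property: relative to a faithful fixed state `σ`, every common fixed point `Z` of
the channels preserving all `ρ t` has a density in the commutant of the Kraus operators. -/
theorem exists_density_of_fixed [DecidableEq m] {T : Type*} {ρ : T → Matrix m m ℂ}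
    {σ Z : Matrix m m ℂ} (hσ : σ.PosDef) (hspan : σ ∈ Submodule.span ℂ (Set.range ρ))
    (hZ : ∀ (K : ℕ) (A : Fin K → Matrix m m ℂ), IsKraus A → (∀ t, Preserves A (ρ t)) →
      Preserves A Z) :
    ∃ X : Matrix m m ℂ, (∀ a : PreservingKraus ρ, a.1 * X = X * a.1) ∧ Z = X * σ := by
  have hu : IsUnit σ.det := (Matrix.isUnit_iff_isUnit_det σ).1 hσ.isUnit
  have hX : Z * σ⁻¹ * σ = Z := by rw [Matrix.mul_assoc, Matrix.nonsing_inv_mul _ hu, Matrix.mul_one]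
  refine ⟨Z * σ⁻¹, ?_, hX.symm⟩
  rintro ⟨M, K, A, k, h1, h2, h3⟩
  have hAσ := preserves_of_mem_span h2 hspan
  have hfix : Preserves A (σ * (Z * σ⁻¹)ᴴ) := by
    have h4 : σ * (Z * σ⁻¹)ᴴ = Zᴴ := by
      nth_rw 1 [← hσ.isHermitian.eq]
      rw [← Matrix.conjTranspose_mul, hX]
    rw [h4]
    have h5 := congrArg Matrix.conjTranspose (hZ K A h1 h2)
    simpa only [Preserves, Matrix.conjTranspose_sum, Matrix.conjTranspose_mul,
      Matrix.conjTranspose_conjTranspose, Matrix.mul_assoc] using h5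
  have hcomm := commute_of_fixes_mul hσ h1 hAσ hfix
  rcases h3 with h3 | h3
  · simpa only [h3] using hcomm k
  · simpa only [h3] using commute_conjTranspose_of_commute hσ h1 hAσ hcomm k

/-- The commutant of the Kraus operators is invariant under conjugation by a faithful fixed
state. -/
theorem exists_mul_eq_mul_of_commute [DecidableEq m] {T : Type*} {ρ : T → Matrix m m ℂ}
    {σ X : Matrix m m ℂ} (hσ : σ.PosDef) (hspan : σ ∈ Submodule.span ℂ (Set.range ρ))
    (hX : ∀ a : PreservingKraus ρ, a.1 * X = X * a.1) :
    ∃ X' : Matrix m m ℂ, (∀ a : PreservingKraus ρ, a.1 * X' = X' * a.1) ∧ σ * X = X' * σ := by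
  refine exists_density_of_fixed hσ hspan fun K A h1 h2 => ?_
  have hAσ := preserves_of_mem_span h2 hspan
  unfold Preserves at hAσ ⊢
  calc ∑ k, A k * (σ * X) * (A k)ᴴ = ∑ k, A k * σ * (A k)ᴴ * X := by
        refine Finset.sum_congr rfl fun k _ => ?_
        have := hX ⟨(A k)ᴴ, K, A, k, h1, h2, Or.inr rfl⟩
        simp only [Matrix.mul_assoc, this]
    _ = σ * X := by rw [← Matrix.sum_mul, hAσ]

end FixedPoints

section BlockForm

variable {N : ℕ} {c f : Fin N → ℕ}

/-- A positive definite matrix whose conjugation maps the algebra `⨁ n, y n ⊗ 1` to itself is of the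
form `⨁ n, h n ⊗ w n`. -/
theorem exists_eq_blockDiagonal_kronecker (hc : ∀ n, 0 < c n) (hf : ∀ n, 0 < f n)
    {σ : Matrix (Σ n, Fin (c n) × Fin (f n)) (Σ n, Fin (c n) × Fin (f n)) ℂ} (hσ : σ.PosDef)
    (h : ∀ y : ∀ n, Matrix (Fin (c n)) (Fin (c n)) ℂ, ∃ y' : ∀ n, Matrix (Fin (c n)) (Fin (c n)) ℂ,
      σ * Matrix.blockDiagonal' (fun n => y n ⊗ₖ (1 : Matrix (Fin (f n)) (Fin (f n)) ℂ)) =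
        Matrix.blockDiagonal' (fun n => y' n ⊗ₖ (1 : Matrix (Fin (f n)) (Fin (f n)) ℂ)) * σ) :
    ∃ (g : ∀ n, Matrix (Fin (c n)) (Fin (c n)) ℂ) (w : ∀ n, Matrix (Fin (f n)) (Fin (f n)) ℂ),
      (∀ n, (g n).PosDef) ∧ (∀ n, IsDensity (w n)) ∧
      σ = Matrix.blockDiagonal' fun n => g n ⊗ₖ w n := by
  -- the blocks of `σ` as matrices between clockwork spaces
  let P : ∀ n n', Fin (f n) → Fin (f n') → Matrix (Fin (c n)) (Fin (c n')) ℂ :=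
    fun n n' b b' => Matrix.of fun i i' => σ ⟨n, i, b⟩ ⟨n', i', b'⟩
  have h' : ∀ y : ∀ n, Matrix (Fin (c n)) (Fin (c n)) ℂ,
      ∃ y' : ∀ n, Matrix (Fin (c n)) (Fin (c n)) ℂ,
        ∀ n n' b b', P n n' b b' * y n' = y' n * P n n' b b' := by
    intro y
    obtain ⟨y', hy'⟩ := h y
    refine ⟨y', fun n n' b b' => ?_⟩
    ext i i'
    have := congrFun (congrFun hy' ⟨n, i, b⟩) ⟨n', i', b'⟩
    simp only [Matrix.mul_apply, Fintype.sum_sigma, Fintype.sum_prod_type] at this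
    rw [Finset.sum_eq_single n' (fun l _ hl => by
        simp [Matrix.blockDiagonal'_apply_ne _ _ _ hl]) (by simp),
      Finset.sum_eq_single n (fun l _ hl => by
        simp [Matrix.blockDiagonal'_apply_ne _ _ _ hl.symm]) (by simp)] at this
    simpa [Matrix.blockDiagonal'_apply_eq, Matrix.one_apply, Matrix.mul_apply, P] using this
  -- the partial traces over the display implement the same automorphism `y ↦ y'` as `σ`
  let g : ∀ n, Matrix (Fin (c n)) (Fin (c n)) ℂ := fun n => ∑ b, P n n b b
  have hg : ∀ n, (g n).PosDef := fun n => by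
    have : Nonempty (Fin (f n)) := ⟨⟨0, hf n⟩⟩
    refine Matrix.posDef_sum Finset.univ_nonempty fun b _ => ?_
    exact hσ.submatrix (e := fun i => ⟨n, i, b⟩) fun i i' hi => by simpa using hi
  have hgu : ∀ n, IsUnit (g n).det := fun n =>
    (Matrix.isUnit_iff_isUnit_det _).1 (hg n).isUnit
  have hgy : ∀ y y' : ∀ n, Matrix (Fin (c n)) (Fin (c n)) ℂ,
      (∀ n n' b b', P n n' b b' * y n' = y' n * P n n' b b') → ∀ n, y' n = g n * y n * (g n)⁻¹ := by
    intro y y' hyy n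
    have : g n * y n = y' n * g n := by simp only [g, Matrix.sum_mul, Matrix.mul_sum, hyy]
    rw [this, Matrix.mul_assoc, Matrix.mul_nonsing_inv _ (hgu n), Matrix.mul_one]
  have hoff : ∀ n n' b b', n ≠ n' → P n n' b b' = 0 := by
    intro n n' b b' hne
    -- conjugation by `σ` fixes the central projectors
    obtain ⟨y', hy'⟩ := h' (fun l => if l = n' then 1 else 0)
    have h1 := hgy _ _ hy' n
    rw [if_neg hne, Matrix.mul_zero, Matrix.zero_mul] at h1
    have h2 := hy' n n' b b'
    rwa [if_pos rfl, Matrix.mul_one, h1, Matrix.zero_mul] at h2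
  have hdiag : ∀ n b b', ∃ z : ℂ, P n n b b' = z • g n := by
    intro n b b'
    have hmem : (g n)⁻¹ * P n n b b' ∈ Set.range (Matrix.scalar (Fin (c n))) := by
      refine Matrix.mem_range_scalar_of_commute_single fun i k _ => ?_
      obtain ⟨y', hy'⟩ := h' (Function.update 0 n (Matrix.single i k 1))
      have h1 := hgy _ _ hy' n
      have h2 := hy' n n b b'
      rw [Function.update_self] at h1 h2
      rw [h1] at h2
      rw [commute_iff_eq, Matrix.mul_assoc, h2, ← Matrix.mul_assoc, ← Matrix.mul_assoc,
        ← Matrix.mul_assoc, ← Matrix.mul_assoc, Matrix.nonsing_inv_mul _ (hgu n), Matrix.one_mul]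
    obtain ⟨z, hz⟩ := hmem
    refine ⟨z, ?_⟩
    have := congrArg (fun M => g n * M) hz
    simp only [← Matrix.mul_assoc, Matrix.mul_nonsing_inv _ (hgu n), Matrix.one_mul] at this
    rw [← this, Matrix.scalar_apply, ← Matrix.smul_one_eq_diagonal, Matrix.mul_smul, Matrix.mul_one]
  choose w hw using hdiag
  have htr : ∀ n, 0 < (g n).trace := fun n => by
    have : Nonempty (Fin (c n)) := ⟨⟨0, hc n⟩⟩
    exact (hg n).trace_pos
  refine ⟨g, fun n => Matrix.of (w n), hg, fun n => ⟨?_, ?_⟩, ?_⟩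
  · have : Matrix.of (w n) = ((g n).trace)⁻¹ •
        ∑ i, σ.submatrix (fun b => (⟨n, i, b⟩ : Σ n, Fin (c n) × Fin (f n)))
          fun b => ⟨n, i, b⟩ := by
      ext b b'
      have h1 := congrArg Matrix.trace (hw n b b')
      rw [Matrix.trace_smul, smul_eq_mul] at h1
      rw [Matrix.smul_apply, Matrix.sum_apply, smul_eq_mul, eq_inv_mul_iff_mul_eq₀ (htr n).ne',
        mul_comm, Matrix.of_apply, ← h1]
      rfl
    change (Matrix.of (w n)).PosSemidef
    rw [this]
    refine Matrix.PosSemidef.smul (Matrix.posSemidef_sum _ fun i _ => hσ.posSemidef.submatrix _) ?_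
    exact (inv_pos_of_pos (htr n)).le
  · have h1 : (∑ b, w n b b) • g n = g n := by
      rw [Finset.sum_smul]
      simp only [← hw]
      rfl
    have h2 := congrArg Matrix.trace h1
    rw [Matrix.trace_smul, smul_eq_mul] at h2
    exact mul_right_cancel₀ (htr n).ne' (h2.trans (one_mul _).symm)
  · ext ⟨n, i, b⟩ ⟨n', i', b'⟩
    by_cases hn : n = n'
    · subst hn
      have := congrFun (congrFun (hw n b b') i) i'
      rw [Matrix.blockDiagonal'_apply_eq, Matrix.kroneckerMap_apply, mul_comm]
      exact this
    · rw [Matrix.blockDiagonal'_apply_ne _ _ _ hn]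
      exact congrFun (congrFun (hoff n n' b b' hn) i) i'

end BlockForm

/-! ### Existence of Koashi-Imoto decompositions -/

section BlockLemmas

theorem blockDiagonal'_sum {κ N α : Type*} [DecidableEq N] [AddCommMonoid α] {p q : N → Type*}
    (s : Finset κ) (M : κ → ∀ n, Matrix (p n) (q n) α) :
    ∑ k ∈ s, Matrix.blockDiagonal' (M k) = Matrix.blockDiagonal' fun n => ∑ k ∈ s, M k n := by
  have := map_sum (Matrix.blockDiagonal'AddMonoidHom p q α) M s
  refine this.symm.trans ?_
  change Matrix.blockDiagonal' (∑ k ∈ s, M k) = _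
  congr 1
  exact funext fun n => Finset.sum_apply n s M

theorem kronecker_sum {κ l m p q : Type*} (s : Finset κ) (g : Matrix l m ℂ)
    (M : κ → Matrix p q ℂ) : ∑ k ∈ s, g ⊗ₖ M k = g ⊗ₖ ∑ k ∈ s, M k := by
  ext x y
  simp only [Matrix.sum_apply, Matrix.kroneckerMap_apply, Finset.mul_sum]

/-- The display factor is determined by a block diagonal matrix with known, non-zero clockwork
factors. -/
theorem eq_of_blockDiagonal'_kronecker_eq {N : Type*} [DecidableEq N] {p q : N → Type*}
    {g : ∀ n, Matrix (p n) (p n) ℂ} {M M' : ∀ n, Matrix (q n) (q n) ℂ}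
    (h : Matrix.blockDiagonal' (fun n => g n ⊗ₖ M n) = Matrix.blockDiagonal' fun n => g n ⊗ₖ M' n)
    {n : N} {i : p n} (hi : g n i i ≠ 0) : M n = M' n := by
  have h1 := congrFun (Matrix.blockDiagonal'_injective h) n
  ext b b'
  have h2 := congrFun (congrFun h1 (i, b)) (i, b')
  simp only [Matrix.kroneckerMap_apply] at h2
  exact mul_left_cancel₀ hi h2

end BlockLemmas

/-- A positive semidefinite matrix is a non-negative multiple of a density matrix, also if it is
zero. -/
theorem exists_smul_isDensity {c : ℕ} (hc : 0 < c) {M : Matrix (Fin c) (Fin c) ℂ}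
    (hM : M.PosSemidef) :
    ∃ (p : ℝ) (τ : Matrix (Fin c) (Fin c) ℂ), 0 ≤ p ∧ IsDensity τ ∧ M = (p : ℂ) • τ := by
  by_cases h0 : M = 0
  · refine ⟨0, ((c : ℂ))⁻¹ • 1, le_rfl, ⟨Matrix.PosSemidef.one.smul ?_, ?_⟩, by simp [h0]⟩
    · exact inv_nonneg.2 (Nat.cast_nonneg c)
    · rw [Matrix.trace_smul, Matrix.trace_one, Fintype.card_fin, smul_eq_mul,
        inv_mul_cancel₀ (Nat.cast_ne_zero.2 hc.ne')]
  · have htr : M.trace ≠ 0 := fun h => h0 (hM.trace_eq_zero_iff.1 h)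
    have hre : ((M.trace.re : ℝ) : ℂ) = M.trace :=
      Complex.ext rfl (Complex.nonneg_iff.1 hM.trace_nonneg).2
    refine ⟨M.trace.re, M.trace⁻¹ • M, (Complex.nonneg_iff.1 hM.trace_nonneg).1,
      ⟨hM.smul (inv_nonneg.2 hM.trace_nonneg), ?_⟩, ?_⟩
    · rw [Matrix.trace_smul, smul_eq_mul, inv_mul_cancel₀ htr]
    · rw [hre, smul_smul, mul_inv_cancel₀ htr, one_smul]

/-- Families of states with a faithful linear combination have a Koashi-Imoto decomposition: the
isotypic decomposition under the Kraus operators of all channels that preserve the states. -/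
theorem nonempty_koashiImoto_of_posDef {T m : Type*} [Fintype m] [DecidableEq m]
    {ρ : T → Matrix m m ℂ} (hρ : ∀ t, IsDensity (ρ t)) {σ : Matrix m m ℂ} (hσ : σ.PosDef)
    (hspan : σ ∈ Submodule.span ℂ (Set.range ρ)) : Nonempty (KoashiImoto ρ) := by
  obtain ⟨N, c, f, U, hU, hU', hcf, hA, hcomm⟩ :=
    (isStarFamily_preservingKraus ρ).exists_isotypic_decomposition
  have hconj : ∀ X Y : Matrix m m ℂ, Uᴴ * (X * Y) * U = (Uᴴ * X * U) * (Uᴴ * Y * U) := by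
    intro X Y
    calc Uᴴ * (X * Y) * U = Uᴴ * X * (1 : Matrix m m ℂ) * (Y * U) := by
          rw [Matrix.mul_one]; simp only [Matrix.mul_assoc]
      _ = _ := by rw [← hU']; simp only [Matrix.mul_assoc]
  have hback : ∀ X : Matrix m m ℂ, U * (Uᴴ * X * U) * Uᴴ = X := fun X => by
    calc U * (Uᴴ * X * U) * Uᴴ = (U * Uᴴ) * X * (U * Uᴴ) := by simp only [Matrix.mul_assoc]
      _ = X := by rw [hU', Matrix.one_mul, Matrix.mul_one]
  have hfwd : ∀ X : Matrix (Σ n, Fin (c n) × Fin (f n)) (Σ n, Fin (c n) × Fin (f n)) ℂ,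
      Uᴴ * (U * X * Uᴴ) * U = X := fun X => by
    calc Uᴴ * (U * X * Uᴴ) * U = (Uᴴ * U) * X * (Uᴴ * U) := by simp only [Matrix.mul_assoc]
      _ = X := by rw [hU, Matrix.one_mul, Matrix.mul_one]
  have hconjT : ∀ X : Matrix m m ℂ, Uᴴ * Xᴴ * U = (Uᴴ * X * U)ᴴ := fun X => by
    simp only [Matrix.conjTranspose_mul, Matrix.conjTranspose_conjTranspose, Matrix.mul_assoc]
  have hinj : Function.Injective U.mulVec := fun x y hxy => by
    have := congrArg (fun v => Uᴴ.mulVec v) hxy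
    simpa only [Matrix.mulVec_mulVec, hU, Matrix.one_mulVec] using this
  obtain ⟨g, w, hg, hw, hgw⟩ := exists_eq_blockDiagonal_kronecker (fun n => (hcf n).1)
    (fun n => (hcf n).2) (hσ.conjTranspose_mul_mul_same hinj) fun y => by
      obtain ⟨X', hX', hX'σ⟩ := exists_mul_eq_mul_of_commute (X := U * Matrix.blockDiagonal'
        (fun n => y n ⊗ₖ (1 : Matrix (Fin (f n)) (Fin (f n)) ℂ)) * Uᴴ) hσ hspan fun a => by
          obtain ⟨B, hB⟩ := hA a
          rw [← hback (a.1 * _), ← hback (_ * a.1), hconj, hconj, hfwd, hB,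
            ← Matrix.blockDiagonal'_mul, ← Matrix.blockDiagonal'_mul]
          simp only [← Matrix.mul_kronecker_mul, Matrix.one_mul, Matrix.mul_one]
      obtain ⟨y', hy'⟩ := hcomm X' hX'
      refine ⟨y', ?_⟩
      have := congrArg (fun M => Uᴴ * M * U) hX'σ
      simpa only [hconj, hfwd, hy'] using this
  have hstate : ∀ t, ∃ x : ∀ n, Matrix (Fin (c n)) (Fin (c n)) ℂ,
      Uᴴ * ρ t * U = Matrix.blockDiagonal' fun n => x n ⊗ₖ w n := fun t => by
    obtain ⟨X, hX, hXσ⟩ := exists_density_of_fixed (Z := ρ t) hσ hspan fun _ _ _ h => h t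
    obtain ⟨y, hy⟩ := hcomm X hX
    refine ⟨fun n => y n * g n, ?_⟩
    rw [hXσ, hconj, hy, hgw, ← Matrix.blockDiagonal'_mul]
    simp only [← Matrix.mul_kronecker_mul, Matrix.one_mul]
  choose x hx using hstate
  -- `x t n` is the partial trace over the display of a block of the state
  have hxpos : ∀ t n, (x t n).PosSemidef := fun t n => by
    have h1 : x t n = ∑ b, (Uᴴ * ρ t * U).submatrix
        (fun i => (⟨n, i, b⟩ : Σ n, Fin (c n) × Fin (f n))) fun i => ⟨n, i, b⟩ := by
      ext i i'
      have h2 : ∑ b, w n b b = 1 := (hw n).2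
      simp only [hx, Matrix.sum_apply, Matrix.submatrix_apply, Matrix.blockDiagonal'_apply_eq,
        Matrix.kroneckerMap_apply, ← Finset.mul_sum, h2, mul_one]
    rw [h1]
    exact Matrix.posSemidef_sum _ fun b _ =>
      ((hρ t).1.conjTranspose_mul_mul_same U).submatrix _
  choose p τ hp hτ hxp using fun t n => exists_smul_isDensity (hcf n).1 (hxpos t n)
  refine ⟨{
    N := N, c := c, f := f, V := U, p := p, clockwork := τ, display := w
    isometry := hU
    support := fun v hv => ?_
    p_nonneg := hp
    p_sum := fun t => ?_
    clockwork_isDensity := hτ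
    display_isDensity := hw
    state_eq := fun t => ?_
    kraus_eq := fun K A hK hAρ => ?_ }⟩
  · have hσv := mulVec_eq_zero_of_mem_span hv hspan
    have hv0 : v = 0 := by
      by_contra hne
      have := hσ.dotProduct_mulVec_pos hne
      rw [hσv, dotProduct_zero] at this
      exact lt_irrefl _ this
    rw [hv0, Matrix.mulVec_zero]
  · have h1 : (Uᴴ * ρ t * U).trace = 1 := by
      rw [Matrix.trace_mul_comm, ← Matrix.mul_assoc, hU', Matrix.one_mul, (hρ t).2]
    rw [hx, Matrix.trace_blockDiagonal'] at h1
    simp only [Matrix.trace_kronecker, hxp, Matrix.trace_smul, (hτ t _).2, (hw _).2, smul_eq_mul,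
      mul_one] at h1
    exact_mod_cast h1
  · rw [← hback (ρ t), hx]
    simp only [hxp, Matrix.smul_kronecker]
  · have hB : ∀ k, ∃ B : ∀ n, Matrix (Fin (f n)) (Fin (f n)) ℂ, Uᴴ * A k * U =
        Matrix.blockDiagonal' fun n => (1 : Matrix (Fin (c n)) (Fin (c n)) ℂ) ⊗ₖ B n :=
      fun k => hA ⟨A k, K, A, k, hK, hAρ, Or.inl rfl⟩
    choose B hB using hB
    refine ⟨B, fun k => ?_, fun n => ?_, fun n => ?_⟩
    · rw [← hB, ← Matrix.mul_assoc, ← Matrix.mul_assoc, hU', Matrix.one_mul]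
    · have h1 : ∑ k, (Uᴴ * A k * U)ᴴ * (Uᴴ * A k * U) = 1 := by
        unfold IsKraus at hK
        simp only [← hconjT, ← hconj, ← Matrix.sum_mul, ← Matrix.mul_sum, hK, Matrix.mul_one, hU]
      simp only [hB, Matrix.blockDiagonal'_conjTranspose, ← Matrix.blockDiagonal'_mul,
        blockDiagonal'_sum, Matrix.conjTranspose_kronecker, ← Matrix.mul_kronecker_mul,
        Matrix.conjTranspose_one, Matrix.one_mul, kronecker_sum] at h1
      have h2 : (1 : Matrix (Σ n, Fin (c n) × Fin (f n)) (Σ n, Fin (c n) × Fin (f n)) ℂ) =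
          Matrix.blockDiagonal' fun n => (1 : Matrix (Fin (c n)) (Fin (c n)) ℂ) ⊗ₖ
            (1 : Matrix (Fin (f n)) (Fin (f n)) ℂ) := by
        simp only [Matrix.one_kronecker_one]
        exact Matrix.blockDiagonal'_one.symm
      rw [h2] at h1
      exact eq_of_blockDiagonal'_kronecker_eq h1 (n := n) (i := ⟨0, (hcf n).1⟩) (by simp)
    · have h1 : ∑ k, (Uᴴ * A k * U) * (Uᴴ * σ * U) * (Uᴴ * A k * U)ᴴ = Uᴴ * σ * U := by
        have := preserves_of_mem_span hAρ hspan
        unfold Preserves at this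
        simp only [← hconjT, ← hconj, ← Matrix.sum_mul, ← Matrix.mul_sum, this]
      simp only [hB, hgw, Matrix.blockDiagonal'_conjTranspose, ← Matrix.blockDiagonal'_mul,
        blockDiagonal'_sum, Matrix.conjTranspose_kronecker, ← Matrix.mul_kronecker_mul,
        Matrix.conjTranspose_one, Matrix.one_mul, Matrix.mul_one, kronecker_sum] at h1
      have : Nonempty (Fin (c n)) := ⟨⟨0, (hcf n).1⟩⟩
      exact eq_of_blockDiagonal'_kronecker_eq h1 (n := n) (i := ⟨0, (hcf n).1⟩)
        (hg n).diag_pos.ne'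

/-- A Koashi-Imoto decomposition of the compressions of the states to their joint support, the range
of the isometry `W`, is one of the states themselves. -/
noncomputable def KoashiImoto.ofCompression {T d m : Type*} [Fintype d] [DecidableEq d] [Fintype m]
    [DecidableEq m] {ρ : T → Matrix d d ℂ} {ρ' : T → Matrix m m ℂ} (D : KoashiImoto ρ')
    (W : Matrix d m ℂ) (hW : Wᴴ * W = 1) (hρ : ∀ t, ρ t = W * ρ' t * Wᴴ)
    (hsupp : ∀ v : d → ℂ, (∀ t, ρ t *ᵥ v = 0) → Wᴴ *ᵥ v = 0)
    (hinv : ∀ (K : ℕ) (A : Fin K → Matrix d d ℂ), IsKraus A → (∀ t, Preserves A (ρ t)) →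
      ∀ k, A k * W = W * (Wᴴ * A k * W)) : KoashiImoto ρ where
  N := D.N
  c := D.c
  f := D.f
  V := W * D.V
  p := D.p
  clockwork := D.clockwork
  display := D.display
  isometry := by
    rw [Matrix.conjTranspose_mul, Matrix.mul_assoc, ← Matrix.mul_assoc Wᴴ, hW, Matrix.one_mul,
      D.isometry]
  support v hv := by
    rw [Matrix.conjTranspose_mul, ← Matrix.mulVec_mulVec, hsupp v hv, Matrix.mulVec_zero]
  p_nonneg := D.p_nonneg
  p_sum := D.p_sum
  clockwork_isDensity := D.clockwork_isDensity
  display_isDensity := D.display_isDensity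
  state_eq t := by
    rw [hρ, D.state_eq, Matrix.conjTranspose_mul]
    simp only [Matrix.mul_assoc]
  kraus_eq K A hA hAρ := by
    have hAW := hinv K A hA hAρ
    obtain ⟨B, hB1, hB2, hB3⟩ := D.kraus_eq K (fun k => Wᴴ * A k * W) (by
        unfold IsKraus at hA ⊢
        calc ∑ k, (Wᴴ * A k * W)ᴴ * (Wᴴ * A k * W)
            = ∑ k, Wᴴ * ((A k)ᴴ * A k) * W := by
              refine Finset.sum_congr rfl fun k _ => ?_
              rw [Matrix.conjTranspose_mul, Matrix.conjTranspose_mul,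
                Matrix.conjTranspose_conjTranspose, Matrix.mul_assoc, Matrix.mul_assoc, ← hAW,
                Matrix.mul_assoc, Matrix.mul_assoc]
          _ = 1 := by rw [← Matrix.sum_mul, ← Matrix.mul_sum, hA, Matrix.mul_one, hW])
      (fun t => by
        have h := hAρ t
        unfold Preserves at h ⊢
        calc ∑ k, Wᴴ * A k * W * ρ' t * (Wᴴ * A k * W)ᴴ
            = ∑ k, Wᴴ * (A k * ρ t * (A k)ᴴ) * W := by
              refine Finset.sum_congr rfl fun k _ => ?_
              simp only [hρ, Matrix.conjTranspose_mul, Matrix.conjTranspose_conjTranspose,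
                Matrix.mul_assoc]
          _ = ρ' t := by
              rw [← Matrix.sum_mul, ← Matrix.mul_sum, h, hρ, Matrix.mul_assoc, Matrix.mul_assoc,
                hW, Matrix.mul_one, ← Matrix.mul_assoc, hW, Matrix.one_mul])
    refine ⟨B, fun k => ?_, hB2, hB3⟩
    rw [← Matrix.mul_assoc, hAW, Matrix.mul_assoc, hB1, Matrix.mul_assoc]

/-- The joint support of a family of positive semidefinite matrices is the support of a positive
semidefinite linear combination. -/
theorem exists_posSemidef_mem_span {T d : Type*} [Fintype d] [DecidableEq d]
    {ρ : T → Matrix d d ℂ} (hρ : ∀ t, (ρ t).PosSemidef) :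
    ∃ σ ∈ Submodule.span ℂ (Set.range ρ), σ.PosSemidef ∧
      ∀ v : d → ℂ, σ *ᵥ v = 0 → ∀ t, ρ t *ᵥ v = 0 := by
  -- a combination with minimal kernel: adding `ρ t` cannot shrink the kernel further
  obtain ⟨_, ⟨σ, ⟨hσ, hσ0⟩, rfl⟩, hmin⟩ := IsArtinian.set_has_minimal
    ((fun σ : Matrix d d ℂ => LinearMap.ker σ.mulVecLin) ''
      {σ | σ ∈ Submodule.span ℂ (Set.range ρ) ∧ σ.PosSemidef})
    ⟨_, 0, ⟨Submodule.zero_mem _, Matrix.PosSemidef.zero⟩, rfl⟩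
  refine ⟨σ, hσ, hσ0, fun v hv t => ?_⟩
  have hsum : ∀ u : d → ℂ, (σ + ρ t) *ᵥ u = 0 → σ *ᵥ u = 0 ∧ ρ t *ᵥ u = 0 := by
    intro u hu
    have h1 : star u ⬝ᵥ σ *ᵥ u + star u ⬝ᵥ ρ t *ᵥ u = 0 := by
      rw [← dotProduct_add, ← Matrix.add_mulVec, hu, dotProduct_zero]
    have h2 := (add_eq_zero_iff_of_nonneg (hσ0.dotProduct_mulVec_nonneg u)
      ((hρ t).dotProduct_mulVec_nonneg u)).1 h1
    exact ⟨(hσ0.dotProduct_mulVec_zero_iff u).1 h2.1,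
      ((hρ t).dotProduct_mulVec_zero_iff u).1 h2.2⟩
  have hle : LinearMap.ker (σ + ρ t).mulVecLin ≤ LinearMap.ker σ.mulVecLin := fun u hu =>
    (hsum u hu).1
  have hnlt := hmin _ ⟨σ + ρ t, ⟨Submodule.add_mem _ hσ (Submodule.subset_span ⟨t, rfl⟩),
    hσ0.add (hρ t)⟩, rfl⟩
  have hge : LinearMap.ker σ.mulVecLin ≤ LinearMap.ker (σ + ρ t).mulVecLin := by
    by_contra hcon
    exact hnlt (lt_of_le_not_ge hle hcon)
  exact (hsum v (hge hv)).2

/-- A positive semidefinite matrix is a positive definite one on its support, the range of the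
isometry `W`. -/
theorem exists_isometry_posDef {d : Type*} [Fintype d] [DecidableEq d] {σ : Matrix d d ℂ}
    (hσ : σ.PosSemidef) :
    ∃ (q : d → Prop) (_ : Fintype {i // q i}) (W : Matrix d {i // q i} ℂ)
      (σ' : Matrix {i // q i} {i // q i} ℂ),
      Wᴴ * W = 1 ∧ σ'.PosDef ∧ σ = W * σ' * Wᴴ := by
  classical
  set U : Matrix d d ℂ := (hσ.isHermitian.eigenvectorUnitary : Matrix d d ℂ) with hU
  set l := hσ.isHermitian.eigenvalues with hl
  have hUU : Uᴴ * U = 1 := Matrix.mem_unitaryGroup_iff'.1 hσ.isHermitian.eigenvectorUnitary.2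
  have hspec : σ = U * Matrix.diagonal (fun i => (l i : ℂ)) * Uᴴ := by
    have := hσ.isHermitian.spectral_theorem
    rw [Unitary.conjStarAlgAut_apply] at this
    exact this
  refine ⟨fun i => l i ≠ 0, inferInstance, U.submatrix id Subtype.val,
    Matrix.diagonal fun i => (l i.1 : ℂ), ?_, ?_, ?_⟩
  · rw [Matrix.conjTranspose_submatrix, ← Matrix.submatrix_mul _ _ _ _ _ Function.bijective_id,
      hUU, Matrix.submatrix_one _ Subtype.val_injective]
  · refine Matrix.PosDef.diagonal fun i => ?_
    exact_mod_cast lt_of_le_of_ne (hσ.eigenvalues_nonneg i.1) (Ne.symm i.2)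
  · conv_lhs => rw [hspec]
    ext r s
    rw [Matrix.mul_apply, Matrix.mul_apply]
    simp only [Matrix.mul_diagonal, Matrix.submatrix_apply, Matrix.conjTranspose_apply, id]
    refine (Fintype.sum_subtype_add_sum_subtype (fun i => l i ≠ 0) fun i => U r i * (l i : ℂ) *
      star (U s i)).symm.trans ?_
    rw [Finset.sum_eq_zero (s := (Finset.univ : Finset {i // ¬ l i ≠ 0})) fun i _ => by
      simp [not_not.1 i.2], add_zero]

/-- Kraus operators of a channel that preserves a state map the support of the state to itself. -/
theorem kraus_mul_isometry {κ d m : Type*} [Fintype κ] [Fintype d] [DecidableEq d] [Fintype m]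
    [DecidableEq m] {W : Matrix d m ℂ} (hW : Wᴴ * W = 1) {σ' : Matrix m m ℂ} (hσ' : σ'.PosDef)
    {A : κ → Matrix d d ℂ} (hA : Preserves A (W * σ' * Wᴴ)) (k : κ) :
    A k * W = W * (Wᴴ * A k * W) := by
  unfold Preserves at hA
  obtain ⟨Q, hQ⟩ : ∃ Q : Matrix d d ℂ, Q = 1 - W * Wᴴ := ⟨_, rfl⟩
  have hQW : Q * W = 0 := by
    rw [hQ, Matrix.sub_mul, Matrix.one_mul, Matrix.mul_assoc, hW, Matrix.mul_one, sub_self]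
  have h0 : Q * (A k * W) = 0 := by
    refine eq_zero_of_sum_trace_eq_zero hσ' (fun k => Q * (A k * W)) ?_ k
    calc ∑ k, (Q * (A k * W) * σ' * (Q * (A k * W))ᴴ).trace
        = (Q * (∑ k, A k * (W * σ' * Wᴴ) * (A k)ᴴ) * Qᴴ).trace := by
          simp only [Matrix.mul_sum, Matrix.sum_mul, Matrix.trace_sum, Matrix.conjTranspose_mul,
            Matrix.mul_assoc]
      _ = 0 := by
          rw [hA, ← Matrix.mul_assoc, ← Matrix.mul_assoc, hQW]
          simp
  rw [hQ, Matrix.sub_mul, Matrix.one_mul, sub_eq_zero] at h0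
  rw [h0]
  simp only [Matrix.mul_assoc]

/-- Every family of states has a Koashi-Imoto decomposition. -/
theorem nonempty_koashiImoto {T d : Type*} [Fintype d] [DecidableEq d] {ρ : T → Matrix d d ℂ}
    (hρ : ∀ t, IsDensity (ρ t)) : Nonempty (KoashiImoto ρ) := by
  obtain ⟨σ, hspan, hσ, hker⟩ := exists_posSemidef_mem_span fun t => (hρ t).1
  obtain ⟨q, _, W, σ', hW, hσ', hσW⟩ := exists_isometry_posDef hσ
  classical
  have hρW : ∀ t, ρ t * (W * Wᴴ) = ρ t := fun t => by
    refine Matrix.ext_of_mulVec_single fun i => ?_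
    rw [← sub_eq_zero, ← Matrix.sub_mulVec]
    have h1 := hker ((1 - W * Wᴴ) *ᵥ Pi.single i 1) (by
      have h2 : σ * (1 - W * Wᴴ) = 0 := by
        rw [hσW, Matrix.mul_sub, Matrix.mul_one, Matrix.mul_assoc _ Wᴴ, ← Matrix.mul_assoc Wᴴ, hW,
          Matrix.one_mul, sub_self]
      rw [Matrix.mulVec_mulVec, h2, Matrix.zero_mulVec]) t
    rw [Matrix.mulVec_mulVec, Matrix.mul_sub, Matrix.mul_one, ← neg_sub, Matrix.neg_mulVec,
      neg_eq_zero] at h1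
    exact h1
  have hρW' : ∀ t, ρ t = W * (Wᴴ * ρ t * W) * Wᴴ := fun t => by
    have h1 := congrArg Matrix.conjTranspose (hρW t)
    rw [Matrix.conjTranspose_mul, (hρ t).1.isHermitian.eq, Matrix.conjTranspose_mul,
      Matrix.conjTranspose_conjTranspose] at h1
    calc ρ t = (W * Wᴴ) * ρ t * (W * Wᴴ) := by rw [h1, hρW]
      _ = _ := by simp only [Matrix.mul_assoc]
  have hσ'W : σ' = Wᴴ * σ * W := by
    rw [hσW]
    calc σ' = (Wᴴ * W) * σ' * (Wᴴ * W) := by rw [hW, Matrix.one_mul, Matrix.mul_one]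
      _ = _ := by simp only [Matrix.mul_assoc]
  have hspan' : σ' ∈ Submodule.span ℂ (Set.range fun t => Wᴴ * ρ t * W) := by
    rw [hσ'W]
    clear hσ hker hσW hσ'W
    induction hspan using Submodule.span_induction with
    | mem x hx => obtain ⟨t, rfl⟩ := hx; exact Submodule.subset_span ⟨t, rfl⟩
    | zero => simp
    | add x y _ _ hx hy => rw [Matrix.mul_add, Matrix.add_mul]; exact Submodule.add_mem _ hx hy
    | smul c x _ hx => rw [Matrix.mul_smul, Matrix.smul_mul]; exact Submodule.smul_mem _ c hx
  have hdens : ∀ t, IsDensity (Wᴴ * ρ t * W) := fun t => by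
    refine ⟨(hρ t).1.conjTranspose_mul_mul_same W, ?_⟩
    rw [Matrix.mul_assoc, Matrix.trace_mul_comm, Matrix.mul_assoc, hρW, (hρ t).2]
  obtain ⟨D⟩ := nonempty_koashiImoto_of_posDef hdens hσ' hspan'
  refine ⟨D.ofCompression W hW hρW' (fun v hv => ?_) fun K A _ hAρ k => ?_⟩
  · have hσv := mulVec_eq_zero_of_mem_span hv hspan
    by_contra hne
    have := hσ'.dotProduct_mulVec_pos hne
    have h3 : σ' *ᵥ (Wᴴ *ᵥ v) = 0 := by
      rw [hσW] at hσv
      have h4 := congrArg (fun u => Wᴴ *ᵥ u) hσv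
      simpa only [Matrix.mulVec_mulVec, ← Matrix.mul_assoc, hW, Matrix.one_mul,
        Matrix.mulVec_zero] using h4
    rw [h3, dotProduct_zero] at this
    exact lt_irrefl _ this
  · exact kraus_mul_isometry hW hσ' (hσW ▸ preserves_of_mem_span hAρ hspan) k

/-! ### Channels given by Kraus operators; attaching and discarding the display -/

/-- The map with Kraus operators `K k` as a completely positive map. The image of a positive
element `star b * b` of the matrices over `Matrix d d ℂ` is a sum of elements `star y * y`, one for
each `k` and each row index `r` of `b i j * (K k)ᴴ`; the row is placed in a square matrix. -/
noncomputable def krausMap {κ d e : Type*} [Fintype κ] [Fintype d] [DecidableEq d] [Fintype e]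
    [DecidableEq e] (K : κ → Matrix e d ℂ) : Matrix d d ℂ →CP Matrix e e ℂ where
  toFun X := ∑ k, K k * X * (K k)ᴴ
  map_add' X Y := by simp only [Matrix.mul_add, Matrix.add_mul, Finset.sum_add_distrib]
  map_smul' a X := by
    simp only [Matrix.mul_smul, Matrix.smul_mul, ← Finset.smul_sum, RingHom.id_apply]
  map_cstarMatrix_nonneg' n M hM := by
    rcases isEmpty_or_nonempty e with he | ⟨⟨e₀⟩⟩
    · exact le_of_eq (CStarMatrix.ext fun i j => Subsingleton.elim _ _)
    change 0 ≤ M.map (fun X : Matrix d d ℂ => ∑ k, K k * X * (K k)ᴴ)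
    rw [StarOrderedRing.nonneg_iff] at hM
    induction hM using AddSubmonoid.closure_induction with
    | zero =>
      refine le_of_eq (CStarMatrix.ext fun i j => ?_)
      simp [CStarMatrix.map_apply]
    | add x y _ _ hx hy =>
      refine (add_nonneg hx hy).trans_eq (CStarMatrix.ext fun i j => ?_)
      simp only [CStarMatrix.map_apply, CStarMatrix.add_apply, Matrix.mul_add, Matrix.add_mul,
        Finset.sum_add_distrib]
    | mem x hx =>
      obtain ⟨b, rfl⟩ := hx
      let y : κ → d → CStarMatrix (Fin n) (Fin n) (Matrix e e ℂ) := fun k r =>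
        CStarMatrix.ofMatrix (Matrix.of fun i j => Matrix.of fun z x =>
          if z = e₀ then ((b i j : Matrix d d ℂ) * (K k)ᴴ : Matrix d e ℂ) r x else 0)
      have hy : (star b * b).map (fun X : Matrix d d ℂ => ∑ k, K k * X * (K k)ᴴ) =
          ∑ k, ∑ r, star (y k r) * y k r := by
        refine CStarMatrix.ext fun i j => ?_
        have hsum : (∑ k, ∑ r, star (y k r) * y k r) i j =
            ∑ k, ∑ r, (star (y k r) * y k r) i j := by
          have h := map_sum (CStarMatrix.ofMatrixₗ (R := ℂ) (m := Fin n) (n := Fin n)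
            (A := Matrix e e ℂ)).symm (fun k => ∑ r, star (y k r) * y k r) Finset.univ
          have h' := fun k => map_sum (CStarMatrix.ofMatrixₗ (R := ℂ) (m := Fin n) (n := Fin n)
            (A := Matrix e e ℂ)).symm (fun r => star (y k r) * y k r) Finset.univ
          simp only [h'] at h
          refine (congrFun (congrFun h i) j).trans ?_
          simp only [Matrix.sum_apply]
          rfl
        rw [hsum, CStarMatrix.map_apply]
        refine Finset.sum_congr rfl fun k _ => ?_
        simp only [CStarMatrix.mul_apply, CStarMatrix.star_apply]
        rw [Finset.sum_comm]
        simp only [Matrix.mul_sum, Matrix.sum_mul]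
        refine Finset.sum_congr rfl fun l _ => ?_
        rw [show K k * (star (b l i) * b l j) * (K k)ᴴ = (b l i * (K k)ᴴ)ᴴ * (b l j * (K k)ᴴ) by
          rw [Matrix.conjTranspose_mul, Matrix.conjTranspose_conjTranspose,
            Matrix.star_eq_conjTranspose]
          simp only [Matrix.mul_assoc]]
        ext z x
        rw [Matrix.sum_apply, Matrix.mul_apply]
        refine Finset.sum_congr rfl fun r _ => ?_
        have happ : ∀ i u v, (y k r l i : Matrix e e ℂ) u v =
            if u = e₀ then ((b l i : Matrix d d ℂ) * (K k)ᴴ : Matrix d e ℂ) r v else 0 :=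
          fun _ _ _ => rfl
        refine Eq.trans ?_ (Matrix.mul_apply (M := star (y k r l i)) (N := y k r l j)).symm
        rw [Finset.sum_eq_single e₀]
        · rw [Matrix.star_apply, happ, happ, if_pos rfl, if_pos rfl, Matrix.conjTranspose_apply]
        · intro u _ hu
          rw [happ, if_neg hu, mul_zero]
        · simp
      rw [hy]
      exact Finset.sum_nonneg fun k _ => Finset.sum_nonneg fun r _ => star_mul_self_nonneg _

theorem krausMap_apply {κ d e : Type*} [Fintype κ] [Fintype d] [DecidableEq d] [Fintype e]
    [DecidableEq e] (K : κ → Matrix e d ℂ) (X : Matrix d d ℂ) :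
    krausMap K X = ∑ k, K k * X * (K k)ᴴ := rfl

theorem isTracePreserving_krausMap {κ d e : Type*} [Fintype κ] [Fintype d] [DecidableEq d]
    [Fintype e] [DecidableEq e] {K : κ → Matrix e d ℂ} (hK : ∑ k, (K k)ᴴ * K k = 1) :
    IsTracePreserving (krausMap K) := fun X => by
  rw [krausMap_apply, Matrix.trace_sum]
  calc ∑ k, (K k * X * (K k)ᴴ).trace = ∑ k, ((K k)ᴴ * K k * X).trace :=
        Finset.sum_congr rfl fun k _ => by
          rw [Matrix.trace_mul_comm, Matrix.mul_assoc]
    _ = X.trace := by rw [← Matrix.trace_sum, ← Matrix.sum_mul, hK, Matrix.one_mul]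

section Ket

variable {N : ℕ} {c f : Fin N → ℕ}

/-- The operator `⨁ n, 1 ⊗ |v n⟩` from `⨁ n, C_n` to `⨁ n, C_n ⊗ F_n`, for `v` in `⨁ n, F_n`. -/
def attach (c : Fin N → ℕ) (v : (Σ n, Fin (f n)) → ℂ) :
    Matrix (Σ n, Fin (c n) × Fin (f n)) (Σ n, Fin (c n)) ℂ :=
  Matrix.of fun y z => if (⟨y.1, y.2.1⟩ : Σ n, Fin (c n)) = z then v ⟨y.1, y.2.2⟩ else 0

theorem attach_mul_apply {p : Type*} (v : (Σ n, Fin (f n)) → ℂ) (Z : Matrix (Σ n, Fin (c n)) p ℂ)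
    (y : Σ n, Fin (c n) × Fin (f n)) (z : p) :
    (attach c v * Z) y z = v ⟨y.1, y.2.2⟩ * Z ⟨y.1, y.2.1⟩ z := by
  simp [attach, Matrix.mul_apply]

theorem mul_attach_conjTranspose_apply {p : Type*} (v : (Σ n, Fin (f n)) → ℂ)
    (Z : Matrix p (Σ n, Fin (c n)) ℂ) (z : p) (y : Σ n, Fin (c n) × Fin (f n)) :
    (Z * (attach c v)ᴴ) z y = Z z ⟨y.1, y.2.1⟩ * star (v ⟨y.1, y.2.2⟩) := by
  simp [attach, Matrix.mul_apply, apply_ite (starRingEnd ℂ)]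

/-- Attaching displays in the states `w n = q n * (q n)ᴴ`. -/
theorem sum_attach_mul_mul {w q : ∀ n, Matrix (Fin (f n)) (Fin (f n)) ℂ}
    (hq : ∀ n, w n = q n * (q n)ᴴ) (Z : ∀ n, Matrix (Fin (c n)) (Fin (c n)) ℂ) :
    ∑ x : Σ n, Fin (f n), attach c (fun y => Matrix.blockDiagonal' q y x) *
      Matrix.blockDiagonal' Z * (attach c fun y => Matrix.blockDiagonal' q y x)ᴴ =
      Matrix.blockDiagonal' fun n => Z n ⊗ₖ w n := by
  have hG : Matrix.blockDiagonal' w = Matrix.blockDiagonal' q * (Matrix.blockDiagonal' q)ᴴ := by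
    rw [Matrix.blockDiagonal'_conjTranspose, ← Matrix.blockDiagonal'_mul, ← funext hq]
  ext ⟨n, i, b⟩ ⟨n', i', b'⟩
  have h1 : ∑ x, Matrix.blockDiagonal' q ⟨n, b⟩ x * star (Matrix.blockDiagonal' q ⟨n', b'⟩ x) =
      Matrix.blockDiagonal' w ⟨n, b⟩ ⟨n', b'⟩ := by
    rw [hG, Matrix.mul_apply]
    rfl
  simp only [Matrix.sum_apply, mul_attach_conjTranspose_apply, attach_mul_apply]
  calc _ = Matrix.blockDiagonal' Z ⟨n, i⟩ ⟨n', i'⟩ * Matrix.blockDiagonal' w ⟨n, b⟩ ⟨n', b'⟩ := by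
        rw [← h1, Finset.mul_sum]
        exact Finset.sum_congr rfl fun x _ => by ring
    _ = _ := by
        by_cases hn : n = n'
        · subst hn
          simp only [Matrix.blockDiagonal'_apply_eq, Matrix.kroneckerMap_apply]
        · simp only [Matrix.blockDiagonal'_apply_ne _ _ _ hn, zero_mul]

theorem attach_conjTranspose_mul_apply {p : Type*} (v : (Σ n, Fin (f n)) → ℂ)
    (M : Matrix (Σ n, Fin (c n) × Fin (f n)) p ℂ) (z : Σ n, Fin (c n)) (w : p) :
    ((attach c v)ᴴ * M) z w = ∑ b, star (v ⟨z.1, b⟩) * M ⟨z.1, z.2, b⟩ w := by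
  obtain ⟨n, i⟩ := z
  rw [Matrix.mul_apply, Fintype.sum_sigma, Finset.sum_eq_single n, Fintype.sum_prod_type,
    Finset.sum_eq_single i]
  · simp [attach]
  · intro i' _ hi
    simp [attach, hi]
  · simp
  · intro n' _ hn
    simp [attach, hn]
  · simp

theorem mul_attach_apply {p : Type*} (v : (Σ n, Fin (f n)) → ℂ)
    (M : Matrix p (Σ n, Fin (c n) × Fin (f n)) ℂ) (z : Σ n, Fin (c n)) (w : p) :
    (M * attach c v) w z = ∑ b, M w ⟨z.1, z.2, b⟩ * v ⟨z.1, b⟩ := by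
  have h := congrArg star (attach_conjTranspose_mul_apply v Mᴴ z w)
  rw [← Matrix.conjTranspose_mul, Matrix.conjTranspose_apply, star_star, star_sum] at h
  rw [h]
  refine Finset.sum_congr rfl fun b _ => ?_
  rw [star_mul', star_star, Matrix.conjTranspose_apply, star_star, mul_comm]

theorem sum_attach_conjTranspose_mul {w q : ∀ n, Matrix (Fin (f n)) (Fin (f n)) ℂ}
    (hq : ∀ n, w n = q n * (q n)ᴴ) (hw : ∀ n, (w n).trace = 1) :
    ∑ x : Σ n, Fin (f n), (attach c fun y => Matrix.blockDiagonal' q y x)ᴴ *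
      attach c (fun y => Matrix.blockDiagonal' q y x) = 1 := by
  have hG : Matrix.blockDiagonal' w = Matrix.blockDiagonal' q * (Matrix.blockDiagonal' q)ᴴ := by
    rw [Matrix.blockDiagonal'_conjTranspose, ← Matrix.blockDiagonal'_mul, ← funext hq]
  ext ⟨n, i⟩ z'
  have h1 : ∑ x, ∑ b, star (Matrix.blockDiagonal' q ⟨n, b⟩ x) * Matrix.blockDiagonal' q ⟨n, b⟩ x =
      1 := by
    rw [Finset.sum_comm, ← hw n]
    refine Finset.sum_congr rfl fun b _ => ?_
    rw [Matrix.diag_apply, ← Matrix.blockDiagonal'_apply_eq w, hG, Matrix.mul_apply]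
    exact Finset.sum_congr rfl fun x _ => mul_comm _ _
  rw [Matrix.sum_apply]
  simp only [attach_conjTranspose_mul_apply]
  by_cases hz : (⟨n, i⟩ : Σ n, Fin (c n)) = z'
  · subst hz
    rw [Matrix.one_apply_eq, ← h1]
    simp only [attach, Matrix.of_apply, if_true]
  · rw [Matrix.one_apply_ne hz]
    simp [attach, hz]

/-- The operator `⨁ n, 1 ⊗ |x⟩` for a vector `x` of the standard basis of the sum of the
displays. -/
noncomputable def attachBasis (c : Fin N → ℕ) (x : Σ n, Fin (f n)) :
    Matrix (Σ n, Fin (c n) × Fin (f n)) (Σ n, Fin (c n)) ℂ :=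
  attach c fun y => (1 : Matrix (Σ n, Fin (f n)) (Σ n, Fin (f n)) ℂ) y x

theorem sum_attachBasis_mul_conjTranspose :
    ∑ x : Σ n, Fin (f n), attachBasis c x * (attachBasis c x)ᴴ = 1 := by
  ext ⟨n, i, b⟩ ⟨n', i', b'⟩
  rw [Matrix.sum_apply]
  simp only [attachBasis, attach_mul_apply]
  by_cases h : (⟨n', i'⟩ : Σ n, Fin (c n)) = ⟨n, i⟩
  · obtain ⟨rfl, h⟩ := Sigma.mk.inj_iff.1 h
    obtain rfl := eq_of_heq h
    simp [attach, Matrix.one_apply]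
  · rw [Matrix.one_apply_ne]
    · simp [attach, h]
    · intro h'
      obtain ⟨rfl, h'⟩ := Sigma.mk.inj_iff.1 h'
      obtain ⟨rfl, rfl⟩ := Prod.mk_inj.1 (eq_of_heq h')
      exact h rfl

/-- Discarding the displays: the map with Kraus operators `⟨x|` is the partial trace. -/
theorem sum_attachBasis_conjTranspose_mul_mul {w : ∀ n, Matrix (Fin (f n)) (Fin (f n)) ℂ}
    (hw : ∀ n, (w n).trace = 1) (Z : ∀ n, Matrix (Fin (c n)) (Fin (c n)) ℂ) :
    ∑ x : Σ n, Fin (f n), (attachBasis c x)ᴴ * Matrix.blockDiagonal' (fun n => Z n ⊗ₖ w n) *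
      attachBasis c x = Matrix.blockDiagonal' Z := by
  ext ⟨n, i⟩ ⟨n', i'⟩
  have h1 : ∀ x : Σ n, Fin (f n),
      ((attachBasis c x)ᴴ * Matrix.blockDiagonal' (fun n => Z n ⊗ₖ w n) * attachBasis c x)
        ⟨n, i⟩ ⟨n', i'⟩ = ∑ b, ∑ b', if (⟨n, b⟩ : Σ n, Fin (f n)) = x ∧ ⟨n', b'⟩ = x then
          Matrix.blockDiagonal' (fun n => Z n ⊗ₖ w n) ⟨n, i, b⟩ ⟨n', i', b'⟩ else 0 := fun x => by
    rw [attachBasis, Matrix.mul_assoc, attach_conjTranspose_mul_apply]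
    refine Finset.sum_congr rfl fun b _ => ?_
    rw [mul_attach_apply, Finset.mul_sum]
    refine Finset.sum_congr rfl fun b' _ => ?_
    by_cases hb : (⟨n, b⟩ : Σ n, Fin (f n)) = x <;> by_cases hb' : (⟨n', b'⟩ : Σ n, Fin (f n)) = x
      <;> simp [hb, hb', Matrix.one_apply]
  rw [Matrix.sum_apply]
  simp only [h1]
  rw [Finset.sum_comm]
  by_cases hn : n = n'
  · subst hn
    rw [Matrix.blockDiagonal'_apply_eq]
    have h2 : ∑ b, w n b b = 1 := hw n
    rw [← mul_one (Z n i i'), ← h2, Finset.mul_sum]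
    refine Finset.sum_congr rfl fun b _ => ?_
    rw [Finset.sum_eq_single ⟨n, b⟩, Finset.sum_eq_single b]
    · simp
    · intro b' _ hb'
      simp [hb']
    · simp
    · intro x _ hx
      exact Finset.sum_eq_zero fun b' _ => if_neg fun h => hx h.1.symm
    · simp
  · simp only [Matrix.blockDiagonal'_apply_ne _ _ _ hn, ite_self, Finset.sum_const_zero]

end Ket

/-! ### The minimal clock -/

section Minimal

/-- The projector of `⨁ n, ℂ^(c n)` onto the block with index `k`. -/
noncomputable def blockProj {N : ℕ} (c : Fin N → ℕ) (k : Fin N) :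
    Matrix (Σ n, Fin (c n)) (Σ n, Fin (c n)) ℂ :=
  Matrix.blockDiagonal' fun n => if n = k then (1 : Matrix (Fin (c n)) (Fin (c n)) ℂ) else 0

theorem blockProj_mul {N : ℕ} {c : Fin N → ℕ} (k : Fin N)
    (Z : ∀ n, Matrix (Fin (c n)) (Fin (c n)) ℂ) :
    blockProj c k * Matrix.blockDiagonal' Z =
      Matrix.blockDiagonal' fun n => if n = k then Z n else 0 := by
  rw [blockProj, ← Matrix.blockDiagonal'_mul]
  simp only [ite_mul, Matrix.one_mul, Matrix.zero_mul]

theorem conjTranspose_blockProj {N : ℕ} {c : Fin N → ℕ} (k : Fin N) :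
    (blockProj c k)ᴴ = blockProj c k := by
  rw [blockProj, Matrix.blockDiagonal'_conjTranspose]
  simp only [apply_ite Matrix.conjTranspose, Matrix.conjTranspose_one, Matrix.conjTranspose_zero]

theorem blockProj_mul_self {N : ℕ} {c : Fin N → ℕ} (k : Fin N) :
    blockProj c k * blockProj c k = blockProj c k := by
  nth_rw 2 [blockProj]
  rw [blockProj_mul, blockProj]
  congr 1
  funext n
  split_ifs <;> rfl

theorem sum_blockProj_mul {N : ℕ} {c : Fin N → ℕ} (Z : ∀ n, Matrix (Fin (c n)) (Fin (c n)) ℂ) :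
    ∑ k, blockProj c k * Matrix.blockDiagonal' Z = Matrix.blockDiagonal' Z := by
  simp only [blockProj_mul, blockDiagonal'_sum, Finset.sum_ite_eq, Finset.mem_univ, if_true]

theorem isKraus_blockProj {N : ℕ} (c : Fin N → ℕ) : IsKraus (blockProj c) := by
  have h := sum_blockProj_mul (c := c) fun n => 1
  unfold IsKraus
  simp only [conjTranspose_blockProj, blockProj_mul_self]
  rw [show (fun n => (1 : Matrix (Fin (c n)) (Fin (c n)) ℂ)) = 1 from rfl,
    Matrix.blockDiagonal'_one] at h
  simpa only [Matrix.mul_one] using h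

/-- Register measurements do not disturb block diagonal matrices. -/
theorem preserves_blockProj {N : ℕ} {c : Fin N → ℕ} (Z : ∀ n, Matrix (Fin (c n)) (Fin (c n)) ℂ) :
    Preserves (blockProj c) (Matrix.blockDiagonal' Z) := by
  unfold Preserves
  refine Eq.trans (Finset.sum_congr rfl fun k _ => ?_) (sum_blockProj_mul Z)
  rw [conjTranspose_blockProj, blockProj_mul, blockProj, ← Matrix.blockDiagonal'_mul]
  congr 1
  funext n
  split_ifs
  · exact Matrix.mul_one _
  · exact Matrix.mul_zero _

end Minimal

namespace KoashiImoto

variable {T d : Type*} [Fintype d] [DecidableEq d] {ρ : T → Matrix d d ℂ} (D : KoashiImoto ρ)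

/-- The state `⨁ n, p_{n|t} ρ_{n|t}` of the minimal clock. -/
noncomputable def minimalState (t : T) : Matrix (Σ n, Fin (D.c n)) (Σ n, Fin (D.c n)) ℂ :=
  Matrix.blockDiagonal' fun n => (D.p t n : ℂ) • D.clockwork t n

theorem isDensity_minimalState (t : T) : IsDensity (D.minimalState t) := by
  constructor
  · -- a block diagonal matrix is the sum of its blocks, conjugated with the inclusions
    have h : D.minimalState t = ∑ n, (Matrix.of fun (i : Fin (D.c n)) (z : Σ n, Fin (D.c n)) =>
        if (⟨n, i⟩ : Σ n, Fin (D.c n)) = z then (1 : ℂ) else 0)ᴴ *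
          ((D.p t n : ℂ) • D.clockwork t n) *
        Matrix.of fun (i : Fin (D.c n)) (z : Σ n, Fin (D.c n)) =>
          if (⟨n, i⟩ : Σ n, Fin (D.c n)) = z then (1 : ℂ) else 0 := by
      ext ⟨n, i⟩ ⟨n', i'⟩
      rw [Matrix.sum_apply, Finset.sum_eq_single n]
      · by_cases hn : n = n'
        · subst hn
          simp [minimalState, Matrix.mul_apply, Matrix.blockDiagonal'_apply_eq]
        · simp [minimalState, Matrix.mul_apply, Matrix.blockDiagonal'_apply_ne _ _ _ hn, hn]
      · intro k _ hk
        simp [Matrix.mul_apply, hk]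
      · simp
    rw [h]
    refine Matrix.posSemidef_sum _ fun n _ =>
      ((D.clockwork_isDensity t n).1.smul ?_).conjTranspose_mul_mul_same _
    exact_mod_cast D.p_nonneg t n
  · rw [minimalState, Matrix.trace_blockDiagonal']
    simp only [Matrix.trace_smul, (D.clockwork_isDensity t _).2, smul_eq_mul, mul_one]
    exact_mod_cast D.p_sum t

/-- The minimal clock: the clockwork and the register, without the display. -/
noncomputable def minimalClock : TickingClock T (Σ n, Fin (D.c n)) (Fin D.N) where
  state := D.minimalState
  kraus := blockProj D.c
  state_isDensity := D.isDensity_minimalState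
  kraus_isKraus := isKraus_blockProj D.c
  undisturbed _ := preserves_blockProj _

/-- Attaching the displays to a block diagonal matrix, and embedding the result. -/
noncomputable def dress (Z : ∀ n, Matrix (Fin (D.c n)) (Fin (D.c n)) ℂ) : Matrix d d ℂ :=
  D.V * Matrix.blockDiagonal' (fun n => Z n ⊗ₖ D.display n) * D.Vᴴ

theorem state_eq_dress (t : T) : ρ t = D.dress fun n => (D.p t n : ℂ) • D.clockwork t n := by
  rw [D.state_eq, dress]
  simp only [Matrix.smul_kronecker]

theorem registerProj_mul_state (k : Fin D.N) (t : T) :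
    D.registerProj k * ρ t =
      D.dress fun n => if n = k then (D.p t n : ℂ) • D.clockwork t n else 0 := by
  have hmul : ∀ X Y : Matrix (Σ n, Fin (D.c n) × Fin (D.f n)) (Σ n, Fin (D.c n) × Fin (D.f n)) ℂ,
      D.V * X * D.Vᴴ * (D.V * Y * D.Vᴴ) = D.V * (X * Y) * D.Vᴴ := fun X Y => by
    rw [Matrix.mul_assoc D.V X, Matrix.mul_assoc D.V, Matrix.mul_assoc X, Matrix.mul_assoc D.V Y,
      ← Matrix.mul_assoc D.Vᴴ, D.isometry, Matrix.one_mul, ← Matrix.mul_assoc X,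
      ← Matrix.mul_assoc D.V]
  rw [D.state_eq, registerProj, dress, hmul, ← Matrix.blockDiagonal'_mul]
  congr 3
  funext n
  split_ifs
  · rw [Matrix.one_kronecker_one, Matrix.one_mul, Matrix.smul_kronecker]
  · rw [Matrix.zero_mul, Matrix.zero_kronecker]

theorem exists_display_factor : ∃ q : ∀ n, Matrix (Fin (D.f n)) (Fin (D.f n)) ℂ,
    ∀ n, D.display n = q n * (q n)ᴴ := by
  have h : ∀ n, ∃ q : Matrix (Fin (D.f n)) (Fin (D.f n)) ℂ, D.display n = q * qᴴ := fun n =>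
    CStarAlgebra.nonneg_iff_eq_mul_star_self.1 (D.display_isDensity n).1.nonneg
  choose q hq using h
  exact ⟨q, hq⟩

/-- The recovery channel attaches the displays in their states `ω_n`. -/
theorem exists_recovery :
    ∃ R : Matrix (Σ n, Fin (D.c n)) (Σ n, Fin (D.c n)) ℂ →CP Matrix d d ℂ,
      IsTracePreserving R ∧ ∀ Z, R (Matrix.blockDiagonal' Z) = D.dress Z := by
  obtain ⟨q, hq⟩ := D.exists_display_factor
  refine ⟨krausMap fun x : Σ n, Fin (D.f n) =>
    D.V * attach D.c fun y => Matrix.blockDiagonal' q y x, isTracePreserving_krausMap ?_,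
    fun Z => ?_⟩
  · rw [← sum_attach_conjTranspose_mul hq fun n => (D.display_isDensity n).2]
    refine Finset.sum_congr rfl fun x _ => ?_
    rw [Matrix.conjTranspose_mul, Matrix.mul_assoc, ← Matrix.mul_assoc D.Vᴴ, D.isometry,
      Matrix.one_mul]
  · rw [krausMap_apply, dress, ← sum_attach_mul_mul hq, Matrix.mul_sum, Matrix.sum_mul]
    refine Finset.sum_congr rfl fun x _ => ?_
    simp only [Matrix.conjTranspose_mul, Matrix.mul_assoc]

/-- The projector onto the complement of the joint support. -/
noncomputable def coProj : Matrix d d ℂ := 1 - D.V * D.Vᴴ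

theorem conjTranspose_coProj : D.coProjᴴ = D.coProj := by
  simp only [coProj, Matrix.conjTranspose_sub, Matrix.conjTranspose_one, Matrix.conjTranspose_mul,
    Matrix.conjTranspose_conjTranspose]

theorem coProj_mul : D.coProj * D.V = 0 := by
  rw [coProj, Matrix.sub_mul, Matrix.one_mul, Matrix.mul_assoc, D.isometry, Matrix.mul_one,
    sub_self]

theorem coProj_mul_self : D.coProj * D.coProj = D.coProj := by
  nth_rw 2 [coProj]
  rw [Matrix.mul_sub, Matrix.mul_one, ← Matrix.mul_assoc, D.coProj_mul, Matrix.zero_mul, sub_zero]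

theorem coProj_mul_dress (Z : ∀ n, Matrix (Fin (D.c n)) (Fin (D.c n)) ℂ) :
    D.coProj * D.dress Z = 0 := by
  rw [dress, ← Matrix.mul_assoc, ← Matrix.mul_assoc, D.coProj_mul, Matrix.zero_mul,
    Matrix.zero_mul]

/-- The reduction channel discards the displays; on the complement of the joint support, where its
action is irrelevant, it prepares the basis state `z₀`. -/
theorem exists_reduction (z₀ : Σ n, Fin (D.c n)) :
    ∃ S : Matrix d d ℂ →CP Matrix (Σ n, Fin (D.c n)) (Σ n, Fin (D.c n)) ℂ,
      IsTracePreserving S ∧ ∀ Z, S (D.dress Z) = Matrix.blockDiagonal' Z := by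
  have hsingle : ∑ a : d, (Matrix.single z₀ a (1 : ℂ))ᴴ * Matrix.single z₀ a (1 : ℂ) = 1 := by
    simp only [Matrix.conjTranspose_single, star_one, Matrix.single_mul_single_same, mul_one]
    exact Matrix.sum_single_one
  refine ⟨krausMap (Sum.elim (fun x : Σ n, Fin (D.f n) => (attachBasis D.c x)ᴴ * D.Vᴴ)
    fun a : d => Matrix.single z₀ a (1 : ℂ) * D.coProj), isTracePreserving_krausMap ?_, fun Z => ?_⟩
  · rw [Fintype.sum_sum_type]
    simp only [Sum.elim_inl, Sum.elim_inr]
    have h1 : ∑ x : Σ n, Fin (D.f n), ((attachBasis D.c x)ᴴ * D.Vᴴ)ᴴ *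
        ((attachBasis D.c x)ᴴ * D.Vᴴ) = D.V * D.Vᴴ := by
      calc _ = D.V * (∑ x : Σ n, Fin (D.f n), attachBasis D.c x * (attachBasis D.c x)ᴴ) *
            D.Vᴴ := by
            rw [Matrix.mul_sum, Matrix.sum_mul]
            refine Finset.sum_congr rfl fun x _ => ?_
            simp only [Matrix.conjTranspose_mul, Matrix.conjTranspose_conjTranspose,
              Matrix.mul_assoc]
        _ = _ := by rw [sum_attachBasis_mul_conjTranspose, Matrix.mul_one]
    have h2 : ∑ a : d, (Matrix.single z₀ a (1 : ℂ) * D.coProj)ᴴ *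
        (Matrix.single z₀ a (1 : ℂ) * D.coProj) = D.coProj := by
      calc _ = D.coProj * (∑ a : d, (Matrix.single z₀ a (1 : ℂ))ᴴ *
            Matrix.single z₀ a (1 : ℂ)) * D.coProj := by
            rw [Matrix.mul_sum, Matrix.sum_mul]
            refine Finset.sum_congr rfl fun x _ => ?_
            rw [Matrix.conjTranspose_mul, D.conjTranspose_coProj]
            simp only [Matrix.mul_assoc]
        _ = _ := by rw [hsingle, Matrix.mul_one, D.coProj_mul_self]
    rw [h1, h2, coProj, add_sub_cancel]
  · rw [krausMap_apply, Fintype.sum_sum_type]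
    simp only [Sum.elim_inl, Sum.elim_inr]
    rw [Finset.sum_eq_zero (s := (Finset.univ : Finset d)) fun a _ => by
      rw [Matrix.mul_assoc (Matrix.single _ _ _), D.coProj_mul_dress, Matrix.mul_zero,
        Matrix.zero_mul], add_zero,
      ← sum_attachBasis_conjTranspose_mul_mul (fun n => (D.display_isDensity n).2) Z]
    refine Finset.sum_congr rfl fun x _ => ?_
    rw [dress, Matrix.conjTranspose_mul, Matrix.conjTranspose_conjTranspose,
      Matrix.conjTranspose_conjTranspose]
    calc _ = (attachBasis D.c x)ᴴ * (D.Vᴴ * D.V) *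
          Matrix.blockDiagonal' (fun n => Z n ⊗ₖ D.display n) * (D.Vᴴ * D.V) *
          attachBasis D.c x := by simp only [Matrix.mul_assoc]
      _ = _ := by rw [D.isometry, Matrix.mul_one, Matrix.mul_one]

/-- The defining property of a Koashi-Imoto decomposition, for an arbitrary finite set of Kraus
operators. -/
theorem exists_kraus_eq {κ : Type*} [Fintype κ] {A : κ → Matrix d d ℂ} (hA : IsKraus A)
    (hAρ : ∀ t, Preserves A (ρ t)) :
    ∃ B : κ → ∀ n, Matrix (Fin (D.f n)) (Fin (D.f n)) ℂ, ∀ k, D.Vᴴ * A k * D.V =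
      Matrix.blockDiagonal' fun n => (1 : Matrix (Fin (D.c n)) (Fin (D.c n)) ℂ) ⊗ₖ B k n := by
  let e := Fintype.equivFin κ
  obtain ⟨B, hB, -⟩ := D.kraus_eq _ (fun k => A (e.symm k))
    ((Equiv.sum_comp e.symm fun k => (A k)ᴴ * A k).trans hA)
    fun t => (Equiv.sum_comp e.symm fun k => A k * ρ t * (A k)ᴴ).trans (hAρ t)
  refine ⟨fun k => B (e k), fun k => ?_⟩
  have h := hB (e k)
  rw [e.symm_apply_apply] at h
  rw [Matrix.mul_assoc, h, ← Matrix.mul_assoc, D.isometry, Matrix.one_mul]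

/-- A channel on the minimal clock that preserves its states is lifted to the original clock:
discard the displays, apply the channel, attach the displays again. The lifted Kraus operators are
trivial on the clockwork, and this determines the original ones. -/
theorem hasTrivialDisplay_minimalState : HasTrivialDisplay D.c D.minimalState := by
  intro K A hA hAρ
  unfold IsKraus at hA
  unfold Preserves at hAρ
  obtain ⟨q, hq⟩ := D.exists_display_factor
  let G : (Σ n, Fin (D.f n)) → (Σ n, Fin (D.f n)) → ℂ := fun x y => Matrix.blockDiagonal' q y x
  let E : Option ((Σ n, Fin (D.f n)) × Fin K × (Σ n, Fin (D.f n))) → Matrix d d ℂ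
    | none => D.coProj
    | some (x', k, x) =>
      D.V * (attach D.c (G x) * A k * (attachBasis D.c x')ᴴ) * D.Vᴴ
  -- `E none` completes the lifted channel on the complement of the joint support
  have hEK : IsKraus E := by
    have h1 : ∑ p, (E (some p))ᴴ * E (some p) = D.V * (∑ x' : Σ n, Fin (D.f n),
        attachBasis D.c x' * (∑ k, (A k)ᴴ *
          (∑ x : Σ n, Fin (D.f n), (attach D.c (G x))ᴴ * attach D.c (G x)) * A k) *
          (attachBasis D.c x')ᴴ) * D.Vᴴ := by
      simp only [Matrix.mul_sum, Matrix.sum_mul, Fintype.sum_prod_type]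
      refine Finset.sum_congr rfl fun x' _ => Finset.sum_congr rfl fun k _ =>
        Finset.sum_congr rfl fun x _ => ?_
      simp only [E, Matrix.conjTranspose_mul, Matrix.conjTranspose_conjTranspose]
      calc D.V * (attachBasis D.c x' * ((A k)ᴴ * (attach D.c (G x))ᴴ) * D.Vᴴ) *
            (D.V * (attach D.c (G x) * A k * (attachBasis D.c x')ᴴ) * D.Vᴴ)
          = D.V * (attachBasis D.c x' * ((A k)ᴴ * (attach D.c (G x))ᴴ)) * (D.Vᴴ * D.V) *
            (attach D.c (G x) * A k * (attachBasis D.c x')ᴴ) * D.Vᴴ := by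
            simp only [Matrix.mul_assoc]
        _ = _ := by
            rw [D.isometry, Matrix.mul_one]
            simp only [Matrix.mul_assoc]
    unfold IsKraus
    rw [Fintype.sum_option, h1, sum_attach_conjTranspose_mul hq fun n =>
      (D.display_isDensity n).2]
    simp only [Matrix.mul_one]
    rw [hA]
    simp only [Matrix.mul_one]
    rw [sum_attachBasis_mul_conjTranspose, Matrix.mul_one]
    change D.coProjᴴ * D.coProj + _ = 1
    rw [D.conjTranspose_coProj, D.coProj_mul_self, coProj, sub_add_cancel]
  have hEρ : ∀ t, Preserves E (ρ t) := by
    intro t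
    have h1 : ∑ p, E (some p) * ρ t * (E (some p))ᴴ = D.V * (∑ x : Σ n, Fin (D.f n),
        attach D.c (G x) * (∑ k, A k * (∑ x' : Σ n, Fin (D.f n), (attachBasis D.c x')ᴴ *
          Matrix.blockDiagonal' (fun n => ((D.p t n : ℂ) • D.clockwork t n) ⊗ₖ D.display n) *
            attachBasis D.c x') * (A k)ᴴ) * (attach D.c (G x))ᴴ) * D.Vᴴ := by
      simp only [Matrix.mul_sum, Matrix.sum_mul]
      rw [Fintype.sum_prod_type, Finset.sum_comm, Fintype.sum_prod_type, Finset.sum_comm]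
      refine Finset.sum_congr rfl fun x _ => Finset.sum_congr rfl fun k _ =>
        Finset.sum_congr rfl fun x' _ => ?_
      obtain ⟨M, hM⟩ : ∃ M, M = Matrix.blockDiagonal' fun n =>
        ((D.p t n : ℂ) • D.clockwork t n) ⊗ₖ D.display n := ⟨_, rfl⟩
      rw [D.state_eq_dress t, dress, ← hM]
      simp only [E, Matrix.conjTranspose_mul, Matrix.conjTranspose_conjTranspose]
      calc D.V * (attach D.c (G x) * A k * (attachBasis D.c x')ᴴ) * D.Vᴴ * (D.V * M * D.Vᴴ) *
            (D.V * (attachBasis D.c x' * ((A k)ᴴ * (attach D.c (G x))ᴴ) * D.Vᴴ))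
          = D.V * (attach D.c (G x) * A k * (attachBasis D.c x')ᴴ) * (D.Vᴴ * D.V) * M *
            (D.Vᴴ * D.V) * (attachBasis D.c x' * ((A k)ᴴ * (attach D.c (G x))ᴴ) * D.Vᴴ) := by
            simp only [Matrix.mul_assoc]
        _ = _ := by
            rw [D.isometry, Matrix.mul_one, Matrix.mul_one]
            simp only [Matrix.mul_assoc]
    unfold Preserves
    rw [Fintype.sum_option, h1, sum_attachBasis_conjTranspose_mul_mul fun n =>
      (D.display_isDensity n).2]
    have h2 := hAρ t
    rw [minimalState] at h2
    rw [h2, sum_attach_mul_mul hq, ← dress, ← D.state_eq_dress]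
    change D.coProj * ρ t * _ + _ = _
    rw [D.state_eq_dress t, D.coProj_mul_dress, Matrix.zero_mul, zero_add]
  obtain ⟨B, hB⟩ := D.exists_kraus_eq hEK hEρ
  have hB' : ∀ k x x', attach D.c (G x) * A k * (attachBasis D.c x')ᴴ =
      Matrix.blockDiagonal' fun n =>
        (1 : Matrix (Fin (D.c n)) (Fin (D.c n)) ℂ) ⊗ₖ B (some (x', k, x)) n := fun k x x' => by
    rw [← hB]
    calc _ = (D.Vᴴ * D.V) * (attach D.c (G x) * A k * (attachBasis D.c x')ᴴ) *
          (D.Vᴴ * D.V) := by rw [D.isometry, Matrix.one_mul, Matrix.mul_one]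
      _ = _ := by simp only [E, Matrix.mul_assoc]
  have hent : ∀ k x x' n i b n' i' b', G x ⟨n, b⟩ * A k ⟨n, i⟩ ⟨n', i'⟩ *
      (if (⟨n', b'⟩ : Σ n, Fin (D.f n)) = x' then 1 else 0) = Matrix.blockDiagonal' (fun n =>
        (1 : Matrix (Fin (D.c n)) (Fin (D.c n)) ℂ) ⊗ₖ B (some (x', k, x)) n)
          ⟨n, i, b⟩ ⟨n', i', b'⟩ := fun k x x' n i b n' i' b' => by
    rw [← hB', attachBasis, mul_attach_conjTranspose_apply, attach_mul_apply, Matrix.one_apply]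
    split_ifs <;> simp
  -- an entry of `q n` that is not zero, to divide by
  have hq0 : ∀ n, ∃ b b', q n b b' ≠ 0 := fun n => by
    by_contra! h
    have h0 : q n = 0 := Matrix.ext h
    have h1 := (D.display_isDensity n).2
    rw [hq, h0, Matrix.zero_mul, Matrix.trace_zero] at h1
    exact zero_ne_one h1
  choose b b' hb using hq0
  have hG : ∀ n, G ⟨n, b' n⟩ ⟨n, b n⟩ = q n (b n) (b' n) := fun n =>
    Matrix.blockDiagonal'_apply_eq _ _ _ _
  refine ⟨fun k n => B (some (⟨n, b n⟩, k, ⟨n, b' n⟩)) n (b n) (b n) / q n (b n) (b' n),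
    fun k => ?_⟩
  ext ⟨n, i⟩ ⟨n', i'⟩
  have h := hent k ⟨n, b' n⟩ ⟨n', b n'⟩ n i (b n) n' i' (b n')
  rw [hG, if_pos rfl, mul_one] at h
  by_cases hn : n = n'
  · subst hn
    rw [Matrix.blockDiagonal'_apply_eq, Matrix.kroneckerMap_apply] at h
    rw [Matrix.blockDiagonal'_apply_eq, Matrix.smul_apply, smul_eq_mul, div_mul_eq_mul_div,
      eq_div_iff (hb n), mul_comm, h, mul_comm]
  · rw [Matrix.blockDiagonal'_apply_ne _ _ _ hn] at h ⊢
    exact (mul_eq_zero.1 h).resolve_left (hb n)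

end KoashiImoto

end QuantumClock

theorem mainTheorem2 {T d κ : Type*} [Nonempty T] [Fintype d] [DecidableEq d] [Fintype κ]
    (clock : QuantumClock.TickingClock T d κ) :
    Nonempty (QuantumClock.KoashiImoto clock.state) ∧
    ∀ D : QuantumClock.KoashiImoto clock.state,
      ∃ minimal : QuantumClock.TickingClock T (Σ n, Fin (D.c n)) (Fin D.N),
        (∀ t, minimal.state t =
          Matrix.blockDiagonal' (fun n => (D.p t n : ℂ) • D.clockwork t n)) ∧
        (∀ k, minimal.kraus k = Matrix.blockDiagonal' (fun n =>
          if n = k then (1 : Matrix (Fin (D.c n)) (Fin (D.c n)) ℂ) else 0)) ∧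
        QuantumClock.HasTrivialDisplay D.c minimal.state ∧
        ∃ (S : Matrix d d ℂ →CP Matrix (Σ n, Fin (D.c n)) (Σ n, Fin (D.c n)) ℂ)
          (R : Matrix (Σ n, Fin (D.c n)) (Σ n, Fin (D.c n)) ℂ →CP Matrix d d ℂ),
          QuantumClock.IsTracePreserving S ∧ QuantumClock.IsTracePreserving R ∧
          (∀ t k, S (D.registerProj k * clock.state t) = minimal.kraus k * minimal.state t ∧
            R (minimal.kraus k * minimal.state t) = D.registerProj k * clock.state t) ∧
          ∀ t, S (clock.state t) = minimal.state t ∧ R (minimal.state t) = clock.state t := by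
  refine ⟨QuantumClock.nonempty_koashiImoto clock.state_isDensity, fun D => ?_⟩
  -- a non-empty block exists because the probabilities `D.p t` of any time `t` add up to one
  obtain ⟨z₀⟩ : Nonempty (Σ n, Fin (D.c n)) := by
    obtain ⟨t⟩ := ‹Nonempty T›
    by_contra hempty
    rw [not_nonempty_iff] at hempty
    have h := (D.isDensity_minimalState t).2
    rw [Matrix.trace, Fintype.sum_empty] at h
    exact zero_ne_one h
  obtain ⟨S, hS, hS'⟩ := D.exists_reduction z₀
  obtain ⟨R, hR, hR'⟩ := D.exists_recovery
  refine ⟨D.minimalClock, fun _ => rfl, fun _ => rfl, D.hasTrivialDisplay_minimalState, S, R,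
    hS, hR, fun t k => ?_, fun t => ?_⟩
  · have h : D.minimalClock.kraus k * D.minimalClock.state t = Matrix.blockDiagonal' fun n =>
        if n = k then (D.p t n : ℂ) • D.clockwork t n else 0 := QuantumClock.blockProj_mul k _
    rw [h, D.registerProj_mul_state]
    exact ⟨hS' _, hR' _⟩
  · rw [D.state_eq_dress t]
    exact ⟨hS' _, hR' fun n => (D.p t n : ℂ) • D.clockwork t n⟩
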